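/- **Model.** The processes are $n$ replicas and a finite but unbounded number of clients. A replica has volatile and non-volatile storage. An implementation is a composition of replica and client automata that communicate by asynchronous message passing over authenticated point-to-point links; it works uniformly for every finite number of clients. An execution is a sequence of global states interleaved with atomic actions (invocations of operations at clients, local steps, message receipts, crashes, restarts; the messages sent and the response returned by a process are part of its action), at most one at each discrete time. Messages are not forged or duplicated, but may be delayed, reordered and lost; in a fair execution every process that is permanently up from some time on takes infinitely many steps, and if two processes are both up at all times from $t$ on, then every message one sends to the other after $t$ is eventually delivered. Clients may crash permanently. In the crash-restart-rollback (CRR) model a replica may crash at any time and may later restart. A restart resets it to a state computed by its restart handler from the content of its non-volatile storage alone (the volatile state is lost). This content is normally the one held at the latest crash; the replica *rolls back* if at some restart the content is reverted to a version older than that. A replica is *correct* if it is up at all times from some time on and never rolls back, and *faulty* otherwise; it is *benign* if it is correct and crashes at least once. A multi-writer/multi-reader (MWMR) register over a set $V$ of at least two values, with initial value $v_0\in V$, lets every client invoke $\mathtt{read}()$ and $\mathtt{write}(v)$ for $v\in V$, one operation at a time. An implementation of it is *atomic* in an execution if the execution is linearizable with respect to the sequential specification of the register, and *wait-free* if every operation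 invoked by a client that never crashes returns. **Theorem.** Let $n,k,r,b$ be natural numbers with $r\le k$ and $b\le n$, and consider the executions in which at most $r$ replicas roll back and at most $b$ replicas are benign. There exists a $k$-tolerant implementation with $n$ replicas of a wait-free atomic MWMR register for CRR (that is, an implementation such that, for every finite number of clients, any of which may crash, every such execution with at most $k$ faulty replicas is linearizable, and wait-free if it is fair) if and only if $$n\ \ge\ 2k+\min(b,r)+1.$$ -/

import Mathlib

universe u

namespace CRR

/-! ## Processes and implementations

The processes are the replicas `Sum.inl i` with `i : Fin n`, and the clients `Sum.inr c` with
`c : ℕ`.  Every single execution has a finite number `m` of clients, namely those with `c < m`; an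
implementation has to work for every `m` and does not know it. -/

/-- A process: one of the `n` replicas, or a client. -/
abbrev Proc (n : ℕ) : Type := Fin n ⊕ ℕ

/-- The operations of a read/write register over the values `V`. -/
inductive Op (V : Type u) : Type u
  | read : Op V
  | write (v : V) : Op V

/-- The responses of a read/write register: `ack` for writes, a value for reads. -/
inductive Resp (V : Type u) : Type u
  | ack : Resp V
  | val (v : V) : Resp V

/-- What may trigger an atomic action of a process: its own local step, or the receipt of a message
over the authenticated link from `src`. -/
inductive Input (n : ℕ) (Msg : Type u) : Type u
  | tick : Input n Msg
  | receive (src : Proc n) (msg : Msg) : Input n Msg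

/-- An implementation of a register over `V` with `n` replicas: the composition of (possibly
nondeterministic) replica and client automata.  An action atomically changes the local state and
sends a finite list of messages, given with their destinations; an action of a client may also
return a response to the caller.  The state of a replica has a volatile part (in `Vol`) and a
non-volatile part (in `NV`).  Upon restart a replica runs `onRestart`, which has access only to the
content of its non-volatile storage.  The handler may start a protocol that continues over several
later actions: its control state is then part of the local state. -/
structure Implementation (n : ℕ) (V : Type u) where
  /-- message contents -/
  Msg : Type u
  /-- volatile part of the state of a replica -/
  Vol : Type u
  /-- content of the non-volatile storage of a replica -/
  NV : Type u
  /-- state of a client -/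
  CState : Type u
  replicaInit : Fin n → Vol × NV
  replicaStep : Fin n → Vol × NV → Input n Msg → Set ((Vol × NV) × List (Proc n × Msg))
  onRestart : Fin n → NV → Set ((Vol × NV) × List (Proc n × Msg))
  clientInit : ℕ → CState
  clientInvoke : ℕ → CState → Op V → Set (CState × List (Proc n × Msg) × Option (Resp V))
  clientStep : ℕ → CState → Input n Msg → Set (CState × List (Proc n × Msg) × Option (Resp V))
  /-- no action ever blocks (an action may of course leave the state unchanged) -/
  replicaStep_nonempty : ∀ i s x, (replicaStep i s x).Nonempty
  onRestart_nonempty : ∀ i w, (onRestart i w).Nonempty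
  clientInvoke_nonempty : ∀ c s o, (clientInvoke c s o).Nonempty
  clientStep_nonempty : ∀ c s x, (clientStep c s x).Nonempty

/-! ## Executions -/

/-- The events of an execution; at most one takes place at each time. -/
inductive Event (n : ℕ) (V : Type u) : Type u
  /-- nothing happens -/
  | idle : Event n V
  /-- client `c` is asked to perform the operation `op` -/
  | invoke (c : ℕ) (op : Op V) : Event n V
  /-- `p` takes a local step -/
  | tick (p : Proc n) : Event n V
  /-- the `j`-th message among those sent at time `s` is delivered to its destination -/
  | deliver (s j : ℕ) : Event n V
  /-- `p` crashes -/
  | crash (p : Proc n) : Event n V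
  /-- replica `i` restarts, and its non-volatile storage has the content that it had at time `s` -/
  | restart (i : Fin n) (s : ℕ) : Event n V

variable {n : ℕ} {V : Type u}

/-- A message together with its source and its destination. -/
structure Envelope (A : Implementation n V) where
  src : Proc n
  dst : Proc n
  payload : A.Msg

/-- A global state, without the messages in transit. The non-volatile storage of a replica that is
down keeps its content; the volatile part has no meaning while the replica is down. -/
structure Config (A : Implementation n V) where
  replica : Fin n → A.Vol × A.NV
  client : ℕ → A.CState
  up : Proc n → Bool

/-- An infinite sequence of global states interleaved with events (finite executions are those which
are idle from some time on), with the messages that are sent and the response that is returned (with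
the client that returns it) at each time. `cfg t` is the state just before the event `ev t`. -/
structure Trace (A : Implementation n V) where
  cfg : ℕ → Config A
  ev : ℕ → Event n V
  sends : ℕ → List (Envelope A)
  resp : ℕ → Option (ℕ × Resp V)

/-- With `m` clients, exactly the clients `c < m` exist. -/
def Present (m : ℕ) : Proc n → Prop
  | Sum.inl _ => True
  | Sum.inr c => c < m

namespace Trace

variable {A : Implementation n V}

/-- The content of the non-volatile storage of replica `i` at time `t`. -/
def nv (E : Trace A) (t : ℕ) (i : Fin n) : A.NV := ((E.cfg t).replica i).2

/-- The operation invoked at time `s` returns the response `ρ` at time `t`: this is the first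
response of its client from time `s` on. -/
def Completes (E : Trace A) (s t : ℕ) (ρ : Resp V) : Prop :=
  ∃ c op, E.ev s = .invoke c op ∧ s ≤ t ∧ E.resp t = some (c, ρ) ∧
    ∀ t', s ≤ t' → t' < t → ∀ ρ', E.resp t' ≠ some (c, ρ')

/-- Just before time `t`, client `c` has an operation that was invoked and has not returned. -/
def Pending (E : Trace A) (c t : ℕ) : Prop :=
  ∃ s op, s < t ∧ E.ev s = .invoke c op ∧ ∀ t', s ≤ t' → t' < t → ∀ ρ, E.resp t' ≠ some (c, ρ)

/-- At time `t` nothing is sent or returned, and the state becomes `C`. -/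
def Silent (E : Trace A) (t : ℕ) (C : Config A) : Prop :=
  E.cfg (t + 1) = C ∧ E.sends t = [] ∧ E.resp t = none

/-- At time `t` replica `i` performs one of the actions in `S` (and is up thereafter). -/
def ReplicaActs (E : Trace A) (t : ℕ) (i : Fin n)
    (S : Set ((A.Vol × A.NV) × List (Proc n × A.Msg))) : Prop :=
  ∃ a ∈ S,
    E.cfg (t + 1) = { E.cfg t with
      replica := Function.update (E.cfg t).replica i a.1
      up := Function.update (E.cfg t).up (Sum.inl i) true } ∧
    E.sends t = a.2.map (fun x => ⟨Sum.inl i, x.1, x.2⟩) ∧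
    E.resp t = none

/-- At time `t` client `c` performs one of the actions in `S`. -/
def ClientActs (E : Trace A) (t : ℕ) (c : ℕ)
    (S : Set (A.CState × List (Proc n × A.Msg) × Option (Resp V))) : Prop :=
  ∃ a ∈ S,
    E.cfg (t + 1) = { E.cfg t with client := Function.update (E.cfg t).client c a.1 } ∧
    E.sends t = a.2.1.map (fun x => ⟨Sum.inr c, x.1, x.2⟩) ∧
    E.resp t = a.2.2.map (fun ρ => (c, ρ))

/-- At time `t` process `p` performs an action triggered by the input `x`. -/
def Acts (E : Trace A) (t : ℕ) (p : Proc n) (x : Input n A.Msg) : Prop :=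
  match p with
  | Sum.inl i => E.ReplicaActs t i (A.replicaStep i ((E.cfg t).replica i) x)
  | Sum.inr c => E.ClientActs t c (A.clientStep c ((E.cfg t).client c) x)

/-- The event at time `t` may happen, and it has the effect prescribed by the implementation `A`,
in a system with `m` clients. Clients are sequential: an operation is invoked only when the previous
one has returned. Messages are neither forged nor duplicated, but they may be delayed, reordered,
and lost. Only replicas restart. -/
def StepAt (m : ℕ) (E : Trace A) (t : ℕ) : Prop :=
  match E.ev t with
  | .idle => E.Silent t (E.cfg t)
  | .invoke c op =>
      c < m ∧ (E.cfg t).up (Sum.inr c) = true ∧ ¬ E.Pending c t ∧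
        E.ClientActs t c (A.clientInvoke c ((E.cfg t).client c) op)
  | .tick p => Present m p ∧ (E.cfg t).up p = true ∧ E.Acts t p .tick
  | .deliver s j =>
      s < t ∧ (∀ t' < t, E.ev t' ≠ .deliver s j) ∧
        ∃ e, (E.sends s)[j]? = some e ∧ Present m e.dst ∧ (E.cfg t).up e.dst = true ∧
          E.Acts t e.dst (.receive e.src e.payload)
  | .crash p =>
      Present m p ∧ (E.cfg t).up p = true ∧
        E.Silent t { E.cfg t with up := Function.update (E.cfg t).up p false }
  | .restart i s =>
      (E.cfg t).up (Sum.inl i) = false ∧ s ≤ t ∧ E.ReplicaActs t i (A.onRestart i (E.nv s i))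

/-- `E` is an execution of `A` with `m` clients. -/
def IsExecution (m : ℕ) (E : Trace A) : Prop :=
  E.cfg 0 = { replica := A.replicaInit, client := A.clientInit, up := fun _ => true } ∧
    ∀ t, E.StepAt m t

/-! ## Failures -/

/-- `p` crashes at least once. -/
def Crashes (E : Trace A) (p : Proc n) : Prop := ∃ t, E.ev t = .crash p

/-- `p` is up at all times from `t` on. -/
def UpFrom (E : Trace A) (p : Proc n) (t : ℕ) : Prop := ∀ t', t ≤ t' → (E.cfg t').up p = true

/-- `p` is eventually up. -/
def EventuallyUp (E : Trace A) (p : Proc n) : Prop := ∃ t, E.UpFrom p t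

/-- Replica `i` rolls back at least once: at some restart, at a time `t`, its non-volatile storage
gets the content of a time `s` after which it has been modified. (The content at time `t` is still
that of the latest crash.) -/
def RollsBack (E : Trace A) (i : Fin n) : Prop :=
  ∃ t s, E.ev t = .restart i s ∧ ∃ s', s ≤ s' ∧ s' ≤ t ∧ E.nv s' i ≠ E.nv t i

/-- A replica is correct if it is eventually up and never rolls back. -/
def Correct (E : Trace A) (i : Fin n) : Prop := E.EventuallyUp (Sum.inl i) ∧ ¬ E.RollsBack i

/-- A replica is benign if it is correct and crashes at least once. -/
def Benign (E : Trace A) (i : Fin n) : Prop := E.Correct i ∧ E.Crashes (Sum.inl i)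

/-- At most `k` replicas are faulty, at most `r` roll back, and at most `b` are benign. -/
def Bounds (E : Trace A) (k r b : ℕ) : Prop :=
  {i | ¬ E.Correct i}.ncard ≤ k ∧ {i | E.RollsBack i}.ncard ≤ r ∧ {i | E.Benign i}.ncard ≤ b

/-- Fairness of an execution with `m` clients: a process that is eventually up takes infinitely many
local steps, and if two processes are up at all times from `t` on, then every message that one of
them sends to the other one at a time `s ≥ t` is eventually delivered. -/
def Fair (m : ℕ) (E : Trace A) : Prop :=
  (∀ p, Present m p → E.EventuallyUp p → ∀ t, ∃ t', t ≤ t' ∧ E.ev t' = .tick p) ∧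
  ∀ t s j e, (E.sends s)[j]? = some e → Present m e.dst → E.UpFrom e.src t → E.UpFrom e.dst t →
    t ≤ s → ∃ t', E.ev t' = .deliver s j

/-! ## Correctness of a register -/

/-- Atomicity (linearizability) with respect to a register with initial value `v₀`. Operations are
identified with their invocation times. Every response answers an operation, and there are a set `L`
of invoked operations that contains all complete ones, and a strict total order `R` on `L` that
extends the real-time order, such that every complete write in `L` returns `ack`, and every complete
read in `L` returns the value of the last write in `L` before it, or `v₀` if there is none. -/
def Linearizable (v₀ : V) (E : Trace A) : Prop :=
  (∀ t c ρ, E.resp t = some (c, ρ) → ∃ s op, E.ev s = .invoke c op ∧ E.Completes s t ρ) ∧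
  ∃ (L : Set ℕ) (R : ℕ → ℕ → Prop),
    (∀ o ∈ L, ∃ c op, E.ev o = .invoke c op) ∧
    (∀ o t ρ, E.Completes o t ρ → o ∈ L) ∧
    (∀ o ∈ L, ¬ R o o) ∧
    (∀ o₁ ∈ L, ∀ o₂ ∈ L, ∀ o₃ ∈ L, R o₁ o₂ → R o₂ o₃ → R o₁ o₃) ∧
    (∀ o₁ ∈ L, ∀ o₂ ∈ L, o₁ ≠ o₂ → R o₁ o₂ ∨ R o₂ o₁) ∧
    (∀ o₁ ∈ L, ∀ o₂ ∈ L, ∀ t ρ, E.Completes o₁ t ρ → t < o₂ → R o₁ o₂) ∧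
    (∀ o c v t ρ, E.ev o = .invoke c (.write v) → E.Completes o t ρ → ρ = .ack) ∧
    (∀ o c t ρ, E.ev o = .invoke c .read → E.Completes o t ρ →
      ∃ v, ρ = .val v ∧
        ((v = v₀ ∧ ∀ w ∈ L, ∀ c' v', E.ev w = .invoke c' (.write v') → ¬ R w o) ∨
          ∃ w ∈ L, ∃ c', E.ev w = .invoke c' (.write v) ∧ R w o ∧
            ∀ w' ∈ L, ∀ c'' v', E.ev w' = .invoke c'' (.write v') → R w' o →
              w' = w ∨ R w' w))

/-- Wait freedom: every operation invoked by a client that never crashes returns. -/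
def WaitFree (E : Trace A) : Prop :=
  ∀ s c op, E.ev s = .invoke c op → ¬ E.Crashes (Sum.inr c) → ∃ t ρ, E.Completes s t ρ

end Trace

/-- `A` is a `k`-tolerant implementation of a wait-free atomic multi-writer/multi-reader register
with initial value `v₀` for the crash-restart-rollback model, under the assumption that at most `r`
replicas roll back and at most `b` replicas are benign: with any finite number `m` of clients, any
of which may crash and each of which may read and write, every execution within these bounds is
linearizable, and wait-free if it is fair. -/
def IsTolerantRegister (A : Implementation n V) (v₀ : V) (k r b : ℕ) : Prop :=
  ∀ (m : ℕ) (E : Trace A), E.IsExecution m → E.Bounds k r b →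
    E.Linearizable v₀ ∧ (E.Fair m → E.WaitFree)

end CRR

/-! Sufficiency. The register is a two-phase quorum protocol. An operation first queries replicas
for their stamped values. It then stores either the largest value found (a read) or its own value
under a larger timestamp (a write). Atomicity reduces to one inequality, `Chosen.le_of_completes`:
if an operation completes before another one starts, the timestamp of the first is at most that of
the second, and strictly smaller if the second is a write. To get it, take a replica in both the
store quorum of the first operation and the query quorum of the second. It suffices that its stored
timestamp has not decreased between the two answers.

This can be guaranteed in two ways, which explains the minimum. If `r ≤ b`, both quorums have `n -
k` members, so they share at least `n - 2k > r` replicas, one of which never rolls back (`sv_mono`).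
If `b < r`, replies of replicas that have ever restarted are ignored in the query phase. A replica
that is still fresh when it answers has never restarted, so its timestamp has only grown
(`fresh_anti`), and a single common replica is enough. Query quorums then have `n - k - b` members,
because that many correct replicas never crash and can be waited for; store quorums keep `n - k`,
and the two sizes add up to more than `n`. Operations are linearized by timestamp (`linearizable`).
Wait freedom holds because enough replicas answer forever (`waitFree`).

Necessity. If `n ≤ 2k + min b r`, the replicas are covered by `X` and `Y` of size at most `k` and
`Z` of size at most `min b r`. In one fair execution `X` is dead from the start and client `0`
completes a write of `v ≠ v₀`. In another one `Y` is dead, the replicas in `Z` crash and restart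
harmlessly before doing anything, and client `1` completes a read, necessarily of `v₀`. Run the
first and then the second with nobody dead: `X` is merely slow during the write, `Y` is merely slow
during the read, and the replicas in `Z` crash in between and roll back to their initial storage. No
acting process can tell the difference, so the read returns `v₀` after the write of `v` has
completed (`Glue.glue`). Only the replicas in `Z` are faulty, and `r ≤ k` makes this admissible. -/

namespace CRR
variable {n : ℕ} {V : Type u}

/-! ## General facts on executions -/

namespace Trace

variable {A : Implementation n V} {m : ℕ} {E : Trace A}

/-- At time `t` process `p` acts, that is, its local state may change. -/
def Moves (E : Trace A) (t : ℕ) (p : Proc n) : Prop :=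
  match E.ev t with
  | .idle => False
  | .invoke c _ => p = .inr c
  | .tick q => p = q
  | .deliver s j => ∃ e, (E.sends s)[j]? = some e ∧ p = e.dst
  | .crash _ => False
  | .restart i _ => p = .inl i

theorem replica_eq_of_not_moves (hE : E.IsExecution m) {t : ℕ} {i : Fin n}
    (h : ¬ E.Moves t (.inl i)) : (E.cfg (t + 1)).replica i = (E.cfg t).replica i := by
  have hs := hE.2 t
  unfold StepAt at hs
  unfold Moves at h
  rcases hev : E.ev t with _ | ⟨c', op⟩ | p | ⟨s, j⟩ | p | ⟨i', s⟩ <;> rw [hev] at hs h <;>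
    simp only at hs h
  · rw [hs.1]
  · obtain ⟨-, -, -, a, -, h1, -⟩ := hs
    rw [h1]
  · obtain ⟨-, -, hs⟩ := hs
    rcases p with i' | c' <;> obtain ⟨a, -, h1, -⟩ := hs <;> rw [h1]
    exact Function.update_of_ne (by rintro rfl; exact h rfl) _ _
  · obtain ⟨-, -, ⟨src, dst, msg⟩, he, -, -, hs⟩ := hs
    rcases dst with i' | c' <;> obtain ⟨a, -, h1, -⟩ := hs <;> rw [h1]
    exact Function.update_of_ne (by rintro rfl; exact h ⟨_, he, rfl⟩) _ _
  · rw [hs.2.2.1]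
  · obtain ⟨-, -, a, -, h1, -⟩ := hs
    rw [h1]
    exact Function.update_of_ne (by rintro rfl; exact h rfl) _ _

theorem client_eq_of_not_moves (hE : E.IsExecution m) {t : ℕ} {c : ℕ}
    (h : ¬ E.Moves t (.inr c)) : (E.cfg (t + 1)).client c = (E.cfg t).client c := by
  have hs := hE.2 t
  unfold StepAt at hs
  unfold Moves at h
  rcases hev : E.ev t with _ | ⟨c', op⟩ | p | ⟨s, j⟩ | p | ⟨i', s⟩ <;> rw [hev] at hs h <;>
    simp only at hs h
  · rw [hs.1]
  · obtain ⟨-, -, -, a, -, h1, -⟩ := hs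
    rw [h1]
    exact Function.update_of_ne (by rintro rfl; exact h rfl) _ _
  · obtain ⟨-, -, hs⟩ := hs
    rcases p with i' | c' <;> obtain ⟨a, -, h1, -⟩ := hs <;> rw [h1]
    exact Function.update_of_ne (by rintro rfl; exact h rfl) _ _
  · obtain ⟨-, -, ⟨src, dst, msg⟩, he, -, -, hs⟩ := hs
    rcases dst with i' | c' <;> obtain ⟨a, -, h1, -⟩ := hs <;> rw [h1]
    exact Function.update_of_ne (by rintro rfl; exact h ⟨_, he, rfl⟩) _ _
  · rw [hs.2.2.1]
  · obtain ⟨-, -, a, -, h1, -⟩ := hs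
    rw [h1]

/-- A process changes between up and down only by crashing or restarting. -/
theorem up_succ (hE : E.IsExecution m) {t : ℕ} {p : Proc n} (hc : E.ev t ≠ .crash p)
    (hr : ∀ i s, E.ev t = .restart i s → p ≠ .inl i) :
    (E.cfg (t + 1)).up p = (E.cfg t).up p := by
  have hs := hE.2 t
  unfold StepAt at hs
  have upd : ∀ i, (E.cfg t).up (.inl i) = true →
      Function.update (E.cfg t).up (.inl i) true p = (E.cfg t).up p := by
    intro i hi
    by_cases hp : p = .inl i
    · subst hp; simp [hi]
    · exact Function.update_of_ne hp _ _
  rcases hev : E.ev t with _ | ⟨c', op⟩ | q | ⟨s, j⟩ | q | ⟨i', s⟩ <;> rw [hev] at hs hc <;>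
    simp only at hs
  · rw [hs.1]
  · obtain ⟨-, -, -, a, -, h1, -⟩ := hs
    rw [h1]
  · obtain ⟨-, hup, hs⟩ := hs
    rcases q with i' | c' <;> obtain ⟨a, -, h1, -⟩ := hs <;> rw [h1]
    exact upd i' hup
  · obtain ⟨-, -, ⟨src, dst, msg⟩, he, -, hup, hs⟩ := hs
    rcases dst with i' | c' <;> obtain ⟨a, -, h1, -⟩ := hs <;> rw [h1]
    exact upd i' hup
  · obtain ⟨-, -, h1, -⟩ := hs
    rw [h1]
    exact Function.update_of_ne (by rintro rfl; exact hc rfl) _ _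
  · obtain ⟨-, -, a, -, h1, -⟩ := hs
    rw [h1]
    exact Function.update_of_ne (hr i' s hev) _ _

theorem up_succ_crash (hE : E.IsExecution m) {t : ℕ} {p : Proc n} (hev : E.ev t = .crash p) :
    (E.cfg (t + 1)).up p = false := by
  have hs := hE.2 t
  unfold StepAt at hs
  rw [hev] at hs
  rw [hs.2.2.1]
  exact Function.update_self ..

theorem up_succ_restart (hE : E.IsExecution m) {t s : ℕ} {i : Fin n}
    (hev : E.ev t = .restart i s) : (E.cfg (t + 1)).up (.inl i) = true := by
  have hs := hE.2 t
  unfold StepAt at hs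
  rw [hev] at hs
  obtain ⟨-, -, a, -, h1, -⟩ := hs
  rw [h1]
  exact Function.update_self ..

theorem up_mono (hE : E.IsExecution m) {t t' : ℕ} {p : Proc n} (htt : t ≤ t')
    (h : (E.cfg t).up p = true) (hc : ∀ s, t ≤ s → s < t' → E.ev s ≠ .crash p) :
    (E.cfg t').up p = true := by
  induction t', htt using Nat.le_induction with
  | base => exact h
  | succ t' ht ih =>
    by_cases hr : ∃ i s, E.ev t' = .restart i s ∧ p = .inl i
    · obtain ⟨i, s, hev, rfl⟩ := hr
      exact up_succ_restart hE hev
    · rw [up_succ hE (hc t' ht t'.lt_succ_self) fun i s hev hp => hr ⟨i, s, hev, hp⟩]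
      exact ih fun s h1 h2 => hc s h1 (h2.trans t'.lt_succ_self)

theorem down_mono (hE : E.IsExecution m) {t t' : ℕ} {p : Proc n} (htt : t ≤ t')
    (h : (E.cfg t).up p = false)
    (hr : ∀ u, t ≤ u → u < t' → ∀ i s, E.ev u = .restart i s → p ≠ .inl i) :
    (E.cfg t').up p = false := by
  induction t', htt using Nat.le_induction with
  | base => exact h
  | succ t' ht ih =>
    by_cases hc : E.ev t' = .crash p
    · exact up_succ_crash hE hc
    · rw [up_succ hE hc (hr t' ht t'.lt_succ_self)]
      exact ih fun u h1 h2 => hr u h1 (h2.trans t'.lt_succ_self)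

theorem upFrom_of_not_crashes (hE : E.IsExecution m) {p : Proc n} (h : ¬ E.Crashes p) :
    E.UpFrom p 0 := fun t _ =>
  up_mono hE (Nat.zero_le t) (by rw [hE.1]) fun s _ _ hs => h ⟨s, hs⟩

end Trace

/-! ## The quorum protocol -/

namespace Quorum

/-- A value with a timestamp: a number and the identifier of the writing client. -/
structure Stamped (V : Type u) : Type u where
  ts : ℕ ×ₗ ℕ
  val : V

/-- The value with the larger timestamp. -/
def Stamped.merge (x y : Stamped V) : Stamped V := if x.ts < y.ts then y else x

theorem Stamped.le_merge_left (x y : Stamped V) : x.ts ≤ (x.merge y).ts := by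
  unfold merge; split_ifs with h
  exacts [h.le, le_rfl]

theorem Stamped.le_merge_right (x y : Stamped V) : y.ts ≤ (x.merge y).ts := by
  unfold merge; split_ifs with h
  exacts [le_rfl, not_lt.mp h]

theorem Stamped.merge_eq (x y : Stamped V) : x.merge y = x ∨ x.merge y = y := by
  unfold merge; split_ifs <;> simp

/-- Requests and replies carry the tag of the client's operation. A reply says whether the replica
has never restarted. -/
inductive Message (V : Type u) : Type u
  | request (tag : ℕ) (x : Stamped V)
  | reply (tag : ℕ) (x : Stamped V) (fresh : Bool)

/-- What a client is doing, with the replicas that have answered in the current phase. -/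
inductive Phase (n : ℕ) (V : Type u) : Type u
  | idle
  | query (op : Op V) (acks : Finset (Fin n)) (best : Stamped V)
  | store (op : Op V) (acks : Finset (Fin n)) (x : Stamped V)

structure Client (n : ℕ) (V : Type u) : Type u where
  tag : ℕ
  phase : Phase n V

/-- The parameters of the protocol: the sizes of the quorums of both phases, and whether replies of
restarted replicas are ignored in the query phase. -/
structure Params (V : Type u) where
  v₀ : V
  strict : Bool
  readQ : ℕ
  writeQ : ℕ

variable (P : Params V)

def Params.init : Stamped V := ⟨toLex (0, 0), P.v₀⟩

/-- The stamped value that is stored by an operation of client `c` that found `x`. -/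
def choose (c : ℕ) : Op V → Stamped V → Stamped V
  | .read, x => x
  | .write v, x => ⟨toLex ((ofLex x.ts).1 + 1, c), v⟩

def response : Op V → Stamped V → Resp V
  | .read, x => .val x.val
  | .write _, _ => .ack

def broadcast (m : Message V) : List (Proc n × Message V) :=
  (List.finRange n).map fun i => (Sum.inl i, m)

def replicaStep (s : ULift.{u} Bool × Stamped V) :
    Input n (Message V) → (ULift.{u} Bool × Stamped V) × List (Proc n × Message V)
  | .receive src (.request tag y) =>
      ((s.1, s.2.merge y), [(src, .reply tag (s.2.merge y) s.1.down)])
  | _ => (s, [])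

/-- What client `c` in state `s` does with a reply of replica `i`. -/
def handle (c : ℕ) (s : Client n V) (i : Fin n) (tag : ℕ) (y : Stamped V) (fresh : Bool) :
    Client n V × Option (Resp V) :=
  match s.phase with
  | .idle => (s, none)
  | .query op acks best =>
      -- The tag ensures that the answer was produced after the current operation was invoked; older
      -- replies still in transit are discarded.
      if tag = s.tag ∧ (P.strict = true → fresh = true) then
        if P.readQ ≤ (insert i acks).card then
          (⟨s.tag, .store op ∅ (choose c op (best.merge y))⟩, none)
        else (⟨s.tag, .query op (insert i acks) (best.merge y)⟩, none)
      else (s, none)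
  | .store op acks x =>
      -- No tag is checked here: a reply at or above `x.ts` proves that the replica has held such a
      -- timestamp, whichever request caused the reply. Replies of restarted replicas count as well.
      if x.ts ≤ y.ts then
        if P.writeQ ≤ (insert i acks).card then (⟨s.tag, .idle⟩, some (response op x))
        else (⟨s.tag, .store op (insert i acks) x⟩, none)
      else (s, none)

/-- The value that a client sends in its current phase. -/
def Phase.payload : Phase n V → Option (Stamped V)
  | .idle => none
  | .query _ _ best => some best
  | .store _ _ x => some x

def clientStep (c : ℕ) (s : Client n V) :
    Input n (Message V) → Client n V × List (Proc n × Message V) × Option (Resp V)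
  | .tick =>
      (s, match s.phase.payload with
        | none => []
        | some x => broadcast (.request s.tag x), none)
  | .receive (.inl i) (.reply tag y fresh) =>
      ((handle P c s i tag y fresh).1, [], (handle P c s i tag y fresh).2)
  | _ => (s, [], none)

variable (n) in
/-- The quorum protocol. -/
@[reducible] def impl : Implementation n V where
  Msg := Message V
  Vol := ULift Bool
  NV := Stamped V
  CState := Client n V
  replicaInit := fun _ => (⟨true⟩, P.init)
  replicaStep := fun _ s x => {replicaStep s x}
  -- The freshness flag is volatile and cleared by every restart, so no rollback can reinstate it.
  onRestart := fun _ w => {((⟨false⟩, w), [])}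
  clientInit := fun _ => ⟨0, .idle⟩
  clientInvoke := fun _ s op => {(⟨s.tag + 1, .query op ∅ P.init⟩, [], none)}
  clientStep := fun c s x => {clientStep P c s x}
  replicaStep_nonempty := fun _ _ _ => Set.singleton_nonempty _
  onRestart_nonempty := fun _ _ => Set.singleton_nonempty _
  clientInvoke_nonempty := fun _ _ _ => Set.singleton_nonempty _
  clientStep_nonempty := fun _ _ _ => Set.singleton_nonempty _

variable {P}

/-! ### Effect of one step of the protocol on clients, replicas and messages -/

abbrev cl (E : Trace (impl n P)) (t c : ℕ) : Client n V := (E.cfg t).client c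

abbrev sv (E : Trace (impl n P)) (t : ℕ) (i : Fin n) : Stamped V := ((E.cfg t).replica i).2

abbrev fr (E : Trace (impl n P)) (t : ℕ) (i : Fin n) : Bool := ((E.cfg t).replica i).1.down

/-- `src` has sent `msg` to `dst` before time `t`. -/
def Sent (E : Trace (impl n P)) (t : ℕ) (src dst : Proc n) (msg : Message V) : Prop :=
  ∃ s < t, (⟨src, dst, msg⟩ : Envelope (impl n P)) ∈ E.sends s

/-- Later arguments about clients mostly go through these three cases instead of unfolding `StepAt`.
The first one includes the client's own ticks, which only send messages. -/
theorem client_cases {m : ℕ} {E : Trace (impl n P)} (hE : E.IsExecution m) (t c : ℕ) :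
    (cl E (t + 1) c = cl E t c ∧ ∀ ρ, E.resp t ≠ some (c, ρ)) ∧ (∀ op, E.ev t ≠ .invoke c op) ∨
    (∃ op, E.ev t = .invoke c op ∧ ¬ E.Pending c t ∧ (∀ ρ, E.resp t ≠ some (c, ρ)) ∧
      cl E (t + 1) c = ⟨(cl E t c).tag + 1, .query op ∅ P.init⟩) ∨
    (∃ s j i tag y fresh, E.ev t = .deliver s j ∧ s < t ∧
      (E.sends s)[j]? = some ⟨.inl i, .inr c, .reply tag y fresh⟩ ∧
      cl E (t + 1) c = (handle P c (cl E t c) i tag y fresh).1 ∧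
      E.resp t = (handle P c (cl E t c) i tag y fresh).2.map fun ρ => (c, ρ)) := by
  have h := hE.2 t
  unfold Trace.StepAt at h
  rcases hev : E.ev t with _ | ⟨c', op⟩ | p | ⟨s, j⟩ | p | ⟨i, s⟩ <;> rw [hev] at h <;> simp only at h
  · left; obtain ⟨h1, h2, h3⟩ := h
    simp [cl, h1, h3]
  · obtain ⟨-, -, hp, a, ha, h1, h2, h3⟩ := h
    simp only [impl, Set.mem_singleton_iff] at ha
    subst ha
    by_cases hc : c' = c
    · subst hc
      right; left
      refine ⟨op, rfl, hp, by simp [h3], ?_⟩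
      simp [cl, h1]
    · left
      refine ⟨⟨?_, by simp [h3]⟩, by simp [hc]⟩
      simp [cl, h1, Function.update_of_ne (Ne.symm hc)]
  · left
    obtain ⟨-, -, h⟩ := h
    rcases p with i | c'
    · obtain ⟨a, ha, h1, h2, h3⟩ := h
      simp [cl, h1, h3]
    · obtain ⟨a, ha, h1, h2, h3⟩ := h
      simp only [impl, Set.mem_singleton_iff] at ha
      subst ha
      refine ⟨⟨?_, by simp [h3, clientStep]⟩, by simp⟩
      simp only [cl, h1, clientStep]
      by_cases hc : c = c'
      · subst hc; simp
      · simp [Function.update_of_ne hc]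
  · obtain ⟨hs, -, ⟨src, dst, msg⟩, he, -, -, h⟩ := h
    rcases dst with i | c'
    · left
      obtain ⟨a, ha, h1, h2, h3⟩ := h
      simp [cl, h1, h3]
    · obtain ⟨a, ha, h1, h2, h3⟩ := h
      simp only [impl, Set.mem_singleton_iff] at ha
      subst ha
      by_cases hc : c = c'
      · subst hc
        rcases src with i | c'
        · rcases msg with ⟨tag, y⟩ | ⟨tag, y, fresh⟩
          · left; simp [cl, h1, h3, clientStep]
          · right; right
            refine ⟨s, j, i, tag, y, fresh, rfl, hs, he, ?_, ?_⟩
            · simp [cl, h1, clientStep]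
            · simp [h3, clientStep]
        · left; simp [cl, h1, h3, clientStep]
      · left
        refine ⟨⟨by simp [cl, h1, Function.update_of_ne hc], ?_⟩, by simp⟩
        intro ρ
        rw [h3]
        rcases clientStep P c' ((E.cfg t).client c') _ with ⟨_, _, _ | ρ'⟩ <;> simp [Ne.symm hc]
  · left; obtain ⟨-, -, h1, h2, h3⟩ := h
    simp [cl, h1, h3]
  · left; obtain ⟨-, -, a, ha, h1, h2, h3⟩ := h
    simp [cl, h1, h3]

/-- The storage can only decrease in the third case, where a restart may reinstate the content of
any earlier time. -/
theorem replica_cases {m : ℕ} {E : Trace (impl n P)} (hE : E.IsExecution m) (t : ℕ) (i : Fin n) :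
    (E.cfg (t + 1)).replica i = (E.cfg t).replica i ∧ (∀ s, E.ev t ≠ .restart i s) ∨
    (∃ src tag y, Sent E t src (.inl i) (.request tag y) ∧ (∀ s, E.ev t ≠ .restart i s) ∧
      (E.cfg (t + 1)).replica i = (((E.cfg t).replica i).1, (sv E t i).merge y)) ∨
    (∃ s ≤ t, E.ev t = .restart i s ∧ (E.cfg (t + 1)).replica i = (⟨false⟩, sv E s i)) := by
  have h := hE.2 t
  unfold Trace.StepAt at h
  rcases hev : E.ev t with _ | ⟨c', op⟩ | p | ⟨s, j⟩ | p | ⟨i', s⟩ <;> rw [hev] at h <;> simp only at h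
  · left; simp [h.1]
  · obtain ⟨-, -, hp, a, ha, h1, h2, h3⟩ := h
    left; simp [h1]
  · left
    obtain ⟨-, -, h⟩ := h
    rcases p with i' | c'
    · obtain ⟨a, ha, h1, h2, h3⟩ := h
      simp only [impl, Set.mem_singleton_iff] at ha
      subst ha
      by_cases hi : i = i'
      · subst hi; simp [h1, replicaStep]
      · simp [h1, Function.update_of_ne hi]
    · obtain ⟨a, ha, h1, h2, h3⟩ := h
      simp [h1]
  · obtain ⟨hs, -, ⟨src, dst, msg⟩, he, -, -, h⟩ := h
    rcases dst with i' | c'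
    · obtain ⟨a, ha, h1, h2, h3⟩ := h
      simp only [impl, Set.mem_singleton_iff] at ha
      subst ha
      by_cases hi : i = i'
      · subst hi
        rcases msg with ⟨tag, y⟩ | ⟨tag, y, fresh⟩
        · right; left
          refine ⟨src, tag, y, ⟨s, hs, List.mem_of_getElem? he⟩, by simp, ?_⟩
          simp [h1, replicaStep, sv]
        · left; simp [h1, replicaStep]
      · left; simp [h1, Function.update_of_ne hi]
    · obtain ⟨a, ha, h1, h2, h3⟩ := h
      left; simp [h1]
  · left; obtain ⟨-, -, h1, h2, h3⟩ := h
    simp [h1]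
  · obtain ⟨-, hs, a, ha, h1, h2, h3⟩ := h
    simp only [impl, Set.mem_singleton_iff] at ha
    subst ha
    by_cases hi : i = i'
    · subst hi
      right; right
      exact ⟨s, hs, rfl, by simp [h1, sv, Trace.nv]⟩
    · left; simp [h1, Function.update_of_ne hi, Ne.symm hi]

theorem send_cases {m : ℕ} {E : Trace (impl n P)} (hE : E.IsExecution m) {t : ℕ}
    {src dst : Proc n} {msg : Message V}
    (he : (⟨src, dst, msg⟩ : Envelope (impl n P)) ∈ E.sends t) :
    (∃ c x, src = .inr c ∧ (cl E t c).phase.payload = some x ∧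
      msg = .request (cl E t c).tag x) ∨
    ∃ i tag y, src = .inl i ∧ Sent E t dst (.inl i) (.request tag y) ∧
      msg = .reply tag (sv E (t + 1) i) (fr E (t + 1) i) := by
  have h := hE.2 t
  unfold Trace.StepAt at h
  rcases hev : E.ev t with _ | ⟨c', op⟩ | p | ⟨s, j⟩ | p | ⟨i', s⟩ <;> rw [hev] at h <;> simp only at h
  · simp [h.2.1] at he
  · obtain ⟨-, -, hp, a, ha, h1, h2, h3⟩ := h
    simp only [impl, Set.mem_singleton_iff] at ha
    subst ha
    simp [h2] at he
  · obtain ⟨-, -, h⟩ := h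
    rcases p with i' | c'
    · obtain ⟨a, ha, h1, h2, h3⟩ := h
      simp only [impl, Set.mem_singleton_iff] at ha
      subst ha
      simp [h2, replicaStep] at he
    · obtain ⟨a, ha, h1, h2, h3⟩ := h
      simp only [impl, Set.mem_singleton_iff] at ha
      subst ha
      left
      rcases hp : (cl E t c').phase.payload with _ | x
      · simp [h2, clientStep, hp] at he
      · simp only [h2, clientStep, hp, List.mem_map] at he
        obtain ⟨a, ha, hae⟩ := he
        simp only [broadcast, List.mem_map] at ha
        obtain ⟨i, -, rfl⟩ := ha
        simp only [Envelope.mk.injEq] at hae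
        exact ⟨c', x, hae.1.symm, hp, hae.2.2.symm⟩
  · obtain ⟨hs, -, ⟨src', dst', msg'⟩, he', -, -, h⟩ := h
    rcases dst' with i' | c'
    · obtain ⟨a, ha, h1, h2, h3⟩ := h
      simp only [impl, Set.mem_singleton_iff] at ha
      subst ha
      rcases msg' with ⟨tag, y⟩ | ⟨tag, y, fresh⟩
      · right
        simp only [h2, replicaStep, List.map_cons, List.map_nil, List.mem_singleton,
          Envelope.mk.injEq] at he
        obtain ⟨rfl, rfl, rfl⟩ := he
        refine ⟨i', tag, y, rfl, ⟨s, hs, List.mem_of_getElem? he'⟩, ?_⟩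
        simp [sv, fr, h1, replicaStep]
      · simp [h2, replicaStep] at he
    · obtain ⟨a, ha, h1, h2, h3⟩ := h
      simp only [impl, Set.mem_singleton_iff] at ha
      subst ha
      rcases src' with i | c <;> rcases msg' with ⟨tag, y⟩ | ⟨tag, y, fresh⟩ <;>
        simp [h2, clientStep] at he
  · simp [h.2.2.2.1] at he
  · obtain ⟨-, hs, a, ha, h1, h2, h3⟩ := h
    simp only [impl, Set.mem_singleton_iff] at ha
    subst ha
    simp [h2] at he

/-! ### Progress of clients -/

def Phase.op? : Phase n V → Option (Op V)
  | .idle => none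
  | .query op _ _ => some op
  | .store op _ _ => some op

/-- A later phase of the same operation. -/
def Phase.Le : Phase n V → Phase n V → Prop
  | .query op a _, .query op' a' _ => op = op' ∧ a ⊆ a'
  | .query op _ _, .store op' _ _ => op = op'
  | .store op a x, .store op' a' x' => op = op' ∧ a ⊆ a' ∧ x = x'
  | _, .idle => True
  | _, _ => False

/-- A later state of a client. -/
def Client.Le (s s' : Client n V) : Prop :=
  s.tag < s'.tag ∨ s.tag = s'.tag ∧ s.phase.Le s'.phase

theorem Client.Le.refl (s : Client n V) : s.Le s := by
  right
  rcases s with ⟨_, _ | _ | _⟩ <;> simp [Phase.Le]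

theorem Client.Le.tag_le {s s' : Client n V} (h : s.Le s') : s.tag ≤ s'.tag := by
  rcases h with h | h
  exacts [h.le, h.1.le]

theorem Client.Le.trans {s₁ s₂ s₃ : Client n V} (h : s₁.Le s₂) (h' : s₂.Le s₃) : s₁.Le s₃ := by
  have := h.tag_le
  have := h'.tag_le
  by_cases hlt : s₁.tag < s₃.tag
  · exact .inl hlt
  rcases h with h | ⟨-, h⟩
  · omega
  rcases h' with h' | ⟨-, h'⟩
  · omega
  refine .inr ⟨by omega, ?_⟩
  rcases s₁ with ⟨_, _ | _ | _⟩ <;> rcases s₂ with ⟨_, _ | _ | _⟩ <;>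
    rcases s₃ with ⟨_, _ | _ | _⟩ <;> simp only [Phase.Le] at h h' ⊢ <;> grind

theorem handle_tag (c : ℕ) (s : Client n V) (i : Fin n) (tag : ℕ) (y : Stamped V) (f : Bool) :
    (handle P c s i tag y f).1.tag = s.tag := by
  unfold handle
  split
  · rfl
  · split_ifs <;> rfl
  · split_ifs <;> rfl

theorem handle_op (c : ℕ) (s : Client n V) (i : Fin n) (tag : ℕ) (y : Stamped V) (f : Bool)
    {op : Op V} (h : (handle P c s i tag y f).1.phase.op? = some op) : s.phase.op? = some op := by
  rcases s with ⟨_, _ | _ | _⟩ <;> simp only [handle] at h <;>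
    (try split_ifs at h) <;> simp_all [Phase.op?]

theorem le_handle (c : ℕ) (s : Client n V) (i : Fin n) (tag : ℕ) (y : Stamped V) (f : Bool) :
    s.Le (handle P c s i tag y f).1 := by
  right
  refine ⟨(handle_tag ..).symm, ?_⟩
  rcases s with ⟨_, _ | _ | _⟩ <;> simp only [handle] <;> (try split_ifs) <;>
    simp [Phase.Le, Finset.subset_insert]

variable {m : ℕ} {E : Trace (impl n P)}

theorem client_le_succ (hE : E.IsExecution m) (t c : ℕ) : (cl E t c).Le (cl E (t + 1) c) := by
  rcases client_cases hE t c with h | ⟨op, -, -, -, h⟩ | ⟨s, j, i, tag, y, f, -, -, -, h, -⟩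
  · rw [h.1.1]; exact .refl _
  · rw [h]; left; simp
  · rw [h]; exact le_handle ..

theorem client_le (hE : E.IsExecution m) {t t' : ℕ} (h : t ≤ t') (c : ℕ) :
    (cl E t c).Le (cl E t' c) := by
  induction h with
  | refl => exact .refl _
  | step _ ih => exact ih.trans (client_le_succ hE _ c)

theorem tag_mono (hE : E.IsExecution m) {t t' : ℕ} (h : t ≤ t') (c : ℕ) :
    (cl E t c).tag ≤ (cl E t' c).tag :=
  (client_le hE h c).tag_le

theorem invoke_spec (hE : E.IsExecution m) {o c : ℕ} {op : Op V} (h : E.ev o = .invoke c op) :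
    ¬ E.Pending c o ∧ (∀ ρ, E.resp o ≠ some (c, ρ)) ∧
      cl E (o + 1) c = ⟨(cl E o c).tag + 1, .query op ∅ P.init⟩ := by
  rcases client_cases hE o c with h' | ⟨op', h1, h2, h3, h4⟩ | ⟨s, j, i, tag, y, f, h', -⟩
  · exact absurd h (h'.2 op)
  · rw [h] at h1; cases h1
    exact ⟨h2, h3, h4⟩
  · rw [h] at h'; cases h'

theorem tag_invoke_lt (hE : E.IsExecution m) {o t c : ℕ} {op : Op V}
    (h : E.ev o = .invoke c op) (ht : o < t) : (cl E o c).tag + 1 ≤ (cl E t c).tag := by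
  have := tag_mono hE (Nat.succ_le_of_lt ht) c
  simpa [(invoke_spec hE h).2.2] using this

theorem exists_invoke (hE : E.IsExecution m) {t c : ℕ} {op : Op V}
    (h : (cl E t c).phase.op? = some op) :
    ∃ o < t, E.ev o = .invoke c op ∧ (cl E o c).tag + 1 = (cl E t c).tag := by
  induction t with
  | zero => simp [cl, hE.1, Phase.op?] at h
  | succ t ih =>
    rcases client_cases hE t c with h' | ⟨op', h1, -, -, h4⟩ | ⟨s, j, i, tag, y, f, -, -, -, h', -⟩
    · rw [h'.1.1] at h ⊢
      obtain ⟨o, ho, ho'⟩ := ih h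
      exact ⟨o, by omega, ho'⟩
    · rw [h4] at h ⊢
      obtain rfl : op' = op := by simpa [Phase.op?] using h
      exact ⟨t, by omega, h1, rfl⟩
    · rw [h'] at h ⊢
      obtain ⟨o, ho, ho'⟩ := ih (handle_op _ _ _ _ _ _ h)
      exact ⟨o, by omega, by rw [handle_tag]; exact ho'⟩

theorem resp_cases (hE : E.IsExecution m) {t c : ℕ} {ρ : Resp V} (h : E.resp t = some (c, ρ)) :
    ∃ op acks x i tag y f, (cl E t c).phase = .store op acks x ∧ ρ = response op x ∧
      cl E (t + 1) c = ⟨(cl E t c).tag, .idle⟩ ∧ P.writeQ ≤ (insert i acks).card ∧ x.ts ≤ y.ts ∧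
      Sent E t (.inl i) (.inr c) (.reply tag y f) := by
  rcases client_cases hE t c with h' | ⟨op', -, -, h3, -⟩ | ⟨s, j, i, tag, y, f, -, hs, he, h', hr⟩
  · exact absurd h (h'.1.2 ρ)
  · exact absurd h (h3 ρ)
  · rw [h] at hr
    rcases hcl : cl E t c with ⟨tag', _ | ⟨op, acks, best⟩ | ⟨op, acks, x⟩⟩ <;>
      rw [hcl] at hr h' <;> simp only [handle] at hr h' <;> (try split_ifs at hr h') <;>
      simp only [Option.map_none, reduceCtorEq, Option.map_some, Option.some.injEq,
        Prod.mk.injEq, true_and] at hr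
    refine ⟨op, acks, x, i, tag, y, f, rfl, hr, h', by assumption, by assumption, s, hs,
      List.mem_of_getElem? he⟩

/-- A response is given only in a store phase and leaves the client idle under the same tag. Since
the state advances monotonically, an idle client needs a new tag before it can answer again, so
there is one response per tag. -/
theorem completes_of_resp (hE : E.IsExecution m) {t c : ℕ} {ρ : Resp V}
    (h : E.resp t = some (c, ρ)) :
    ∃ o op, o < t ∧ E.ev o = .invoke c op ∧ E.Completes o t ρ ∧
      (cl E o c).tag + 1 = (cl E t c).tag ∧ (cl E t c).phase.op? = some op := by
  obtain ⟨op, acks, x, i, tag, y, f, hp, -, -⟩ := resp_cases hE h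
  have hop : (cl E t c).phase.op? = some op := by rw [hp]; rfl
  obtain ⟨o, ho, hev, htag⟩ := exists_invoke hE hop
  refine ⟨o, op, ho, hev, ⟨c, op, hev, ho.le, h, fun t' h1 h2 ρ' hr => ?_⟩, htag, hop⟩
  obtain ⟨-, -, -, -, -, -, -, -, -, h3, -⟩ := resp_cases hE hr
  rcases h1.eq_or_lt with rfl | h1
  · exact (invoke_spec hE hev).2.1 _ hr
  have h4 := tag_invoke_lt hE hev h1
  have h5 := client_le hE (Nat.succ_le_of_lt h2) c
  rw [Nat.succ_eq_add_one, h3] at h5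
  rcases h5 with h5 | ⟨-, h5⟩
  · simp only at h5; omega
  · rw [hp] at h5; exact h5

theorem completes_spec (hE : E.IsExecution m) {o t c : ℕ} {op : Op V} {ρ : Resp V}
    (hev : E.ev o = .invoke c op) (h : E.Completes o t ρ) :
    o < t ∧ ∃ acks x i tag y f, cl E t c = ⟨(cl E o c).tag + 1, .store op acks x⟩ ∧
      ρ = response op x ∧ P.writeQ ≤ (insert i acks).card ∧ x.ts ≤ y.ts ∧
      Sent E t (.inl i) (.inr c) (.reply tag y f) := by
  obtain ⟨c', op', hev', hot, hr, hmin⟩ := h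
  rw [hev] at hev'; cases hev'
  obtain ⟨o', op', hlt, hev', -, htag, hop⟩ := completes_of_resp hE hr
  have hot' : o < t := lt_of_le_of_ne hot (by rintro rfl; exact (invoke_spec hE hev).2.1 _ hr)
  -- `completes_of_resp` yields some invocation `o'` for the response. If it were later than `o`, it
  -- would have been made while `o` was pending; if earlier, the tag at `t` would be too large.
  obtain rfl : o = o' := by
    rcases lt_trichotomy o o' with h1 | h1 | h1
    · refine absurd ⟨o, op, h1, hev, fun t' h2 h3 ρ => ?_⟩ (invoke_spec hE hev').1
      exact hmin t' h2 (h3.trans hlt) ρ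
    · exact h1
    · have := tag_invoke_lt hE hev' h1
      have := tag_invoke_lt hE hev hot'
      omega
  rw [hev] at hev'; cases hev'
  obtain ⟨op', acks, x, i, tag, y, f, hp, h1, -, h2, h3, h4⟩ := resp_cases hE hr
  obtain rfl : op' = op := by rw [hp] at hop; simpa [Phase.op?] using hop
  refine ⟨hot', acks, x, i, tag, y, f, ?_, h1, h2, h3, h4⟩
  rw [htag, ← hp]

/-- The operation invoked at time `o` stores `x`. -/
def Chosen (E : Trace (impl n P)) (o c : ℕ) (op : Op V) (x : Stamped V) : Prop :=
  E.ev o = .invoke c op ∧ ∃ t acks, o < t ∧ cl E t c = ⟨(cl E o c).tag + 1, .store op acks x⟩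

/-- Under a fixed tag the order `Client.Le` freezes the value of a store phase. -/
theorem Chosen.unique (hE : E.IsExecution m) {o c c' : ℕ} {op op' : Op V} {x x' : Stamped V}
    (h : Chosen E o c op x) (h' : Chosen E o c' op' x') : x = x' := by
  obtain ⟨hev, t, acks, -, h⟩ := h
  obtain ⟨hev', t', acks', -, h'⟩ := h'
  rw [hev] at hev'; cases hev'
  have key : ∀ {s s' : ℕ} {a a' : Finset (Fin n)} {y y' : Stamped V}, s ≤ s' →
      cl E s c = ⟨(cl E o c).tag + 1, .store op a y⟩ →
      cl E s' c = ⟨(cl E o c).tag + 1, .store op a' y'⟩ → y = y' := by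
    intro s s' a a' y y' hle h h'
    have := client_le hE hle c
    rw [h, h'] at this
    rcases this with h | h
    · exact absurd h (lt_irrefl _)
    · exact h.2.2.2
  rcases le_total t t' with hle | hle
  · exact key hle h h'
  · exact (key hle h' h).symm

theorem completes_of_lt (hE : E.IsExecution m) {o o' c : ℕ} {op op' : Op V}
    (h : E.ev o = .invoke c op) (h' : E.ev o' = .invoke c op') (hlt : o < o') :
    ∃ t < o', ∃ ρ, E.Completes o t ρ := by
  classical
  have hp := (invoke_spec hE h').1
  simp only [Trace.Pending, not_exists, not_and, not_forall, not_not] at hp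
  have hex : ∃ t, o ≤ t ∧ t < o' ∧ ∃ ρ, E.resp t = some (c, ρ) := by
    obtain ⟨t, h1, h2, ρ, h3⟩ := hp o op hlt h
    exact ⟨t, h1, h2, ρ, h3⟩
  obtain ⟨h1, h2, ρ, h3⟩ := Nat.find_spec hex
  refine ⟨_, h2, ρ, c, op, h, h1, h3, fun t' h4 h5 ρ' h6 => ?_⟩
  exact Nat.find_min hex h5 ⟨h4, h5.trans h2, ρ', h6⟩

/-! ### Provenance of values -/

/-- `x` is the initial value, or a client writes it no later than `t`. -/
def Provided (E : Trace (impl n P)) (t : ℕ) (x : Stamped V) : Prop :=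
  x = P.init ∨ ∃ c v t' acks, t' ≤ t ∧ (cl E t' c).phase = .store (.write v) acks x

theorem Provided.mono {t t' : ℕ} {x : Stamped V} (h : Provided E t x) (ht : t ≤ t') :
    Provided E t' x := by
  rcases h with h | ⟨c, v, s, acks, hs, h⟩
  · exact .inl h
  · exact .inr ⟨c, v, s, acks, hs.trans ht, h⟩

theorem Provided.merge {t : ℕ} {x y : Stamped V} (hx : Provided E t x) (hy : Provided E t y) :
    Provided E t (x.merge y) := by
  rcases x.merge_eq y with h | h <;> rwa [h]

theorem Sent.cases {t : ℕ} {src dst : Proc n} {msg : Message V} (h : Sent E (t + 1) src dst msg) :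
    Sent E t src dst msg ∨ (⟨src, dst, msg⟩ : Envelope (impl n P)) ∈ E.sends t := by
  obtain ⟨s, hs, h⟩ := h
  rcases Nat.lt_succ_iff_lt_or_eq.mp hs with hs | rfl
  · exact .inl ⟨s, hs, h⟩
  · exact .inr h

/-- Values circulate between storage, clients, requests and replies, so the four claims need a
simultaneous induction. The claim on storage covers all times up to `t` because a restart may return
to any of them. -/
theorem provided (hE : E.IsExecution m) (t : ℕ) :
    (∀ i, ∀ s ≤ t, Provided E t (sv E s i)) ∧
    (∀ c x, (cl E t c).phase.payload = some x → Provided E t x) ∧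
    (∀ src dst tag x, Sent E t src dst (.request tag x) → Provided E t x) ∧
    (∀ src dst tag x f, Sent E t src dst (.reply tag x f) → Provided E t x) := by
  induction t with
  | zero =>
    refine ⟨?_, ?_, ?_, ?_⟩
    · rintro i s hs
      obtain rfl : s = 0 := by omega
      left; simp [sv, hE.1]
    · intro c x h
      simp [cl, hE.1, Phase.payload] at h
    · rintro _ _ _ _ ⟨s, hs, -⟩
      omega
    · rintro _ _ _ _ _ ⟨s, hs, -⟩
      omega
  | succ t ih =>
    obtain ⟨ih1, ih2, ih3, ih4⟩ := ih
    have h1 : ∀ i, ∀ s ≤ t + 1, Provided E (t + 1) (sv E s i) := by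
      intro i s hs
      rcases Nat.le_succ_iff.mp hs with hs | rfl
      · exact (ih1 i s hs).mono t.le_succ
      refine Provided.mono (t := t) ?_ t.le_succ
      rcases replica_cases hE t i with ⟨h, -⟩ | ⟨src, tag, y, hs, -, h⟩ | ⟨s, hs, -, h⟩
      · simp only [sv, h]
        exact ih1 i t le_rfl
      · simp only [sv, h]
        exact (ih1 i t le_rfl).merge (ih3 _ _ _ _ hs)
      · simp only [sv, h]
        exact ih1 i s hs
    refine ⟨h1, ?_, ?_, ?_⟩
    · intro c x hx
      rcases client_cases hE t c with h | ⟨op, -, -, -, h⟩ | ⟨s, j, i, tag, y, f, -, hs, he, h, -⟩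
      · rw [h.1.1] at hx
        exact (ih2 c x hx).mono t.le_succ
      · rw [h] at hx
        left
        simpa [Phase.payload] using hx.symm
      · have hy : Provided E (t + 1) y :=
          (ih4 _ _ _ _ _ ⟨s, hs, List.mem_of_getElem? he⟩).mono t.le_succ
        have h2 : ∀ x, (cl E t c).phase.payload = some x → Provided E (t + 1) x :=
          fun x h => (ih2 c x h).mono t.le_succ
        rcases hcl : cl E t c with ⟨tag', _ | ⟨op, acks, best⟩ | ⟨op, acks, x'⟩⟩
        · rw [hcl] at h; rw [h] at hx; simp [handle, Phase.payload] at hx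
        · rw [hcl] at h h2
          have hb := (h2 best rfl).merge hy
          simp only [handle] at h
          split_ifs at h
          · rcases op with _ | v
            · rw [h] at hx
              obtain rfl : best.merge y = x := by simpa [Phase.payload, choose] using hx
              exact hb
            · right
              refine ⟨c, v, t + 1, ∅, le_rfl, ?_⟩
              rw [h] at hx ⊢
              obtain rfl : _ = x := by simpa [Phase.payload] using hx
              rfl
          · rw [h] at hx
            obtain rfl : best.merge y = x := by simpa [Phase.payload] using hx
            exact hb
          · rw [h] at hx
            exact h2 x hx
        · rw [hcl] at h h2
          simp only [handle] at h
          split_ifs at h <;> rw [h] at hx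
          · simp [Phase.payload] at hx
          · exact h2 x hx
          · exact h2 x hx
    · intro src dst tag x h
      rcases h.cases with h | h
      · exact (ih3 _ _ _ _ h).mono t.le_succ
      · rcases send_cases hE h with ⟨c, x', -, h2, h3⟩ | ⟨i, tag', y, -, -, h3⟩
        · cases h3
          exact (ih2 _ _ h2).mono t.le_succ
        · cases h3
    · intro src dst tag x f h
      rcases h.cases with h | h
      · exact (ih4 _ _ _ _ _ h).mono t.le_succ
      · rcases send_cases hE h with ⟨c, x', -, h2, h3⟩ | ⟨i, tag', y, -, -, h3⟩
        · cases h3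
        · cases h3
          exact h1 _ _ le_rfl

/-! ### Quorums -/

/-- Links cannot forge: a reply reflects the replica's state right after a request of the same
client was delivered. The time `b'` at which that request was sent bounds the age of the answer from
below. -/
theorem reply_spec (hE : E.IsExecution m) {t c tag : ℕ} {i : Fin n} {y : Stamped V} {f : Bool}
    (h : Sent E t (.inl i) (.inr c) (.reply tag y f)) :
    ∃ b < t, y = sv E (b + 1) i ∧ f = fr E (b + 1) i ∧ ∃ b' < b, (cl E b' c).tag = tag := by
  obtain ⟨b, hb, h⟩ := h
  rcases send_cases hE h with ⟨c', x', h1, -⟩ | ⟨i', tag', y', h1, ⟨b', hb', h2⟩, h3⟩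
  · cases h1
  · cases h1; cases h3
    refine ⟨b, hb, rfl, rfl, b', hb', ?_⟩
    rcases send_cases hE h2 with ⟨c', x', h1, -, h3⟩ | ⟨i', tag', y', -, -, h3⟩
    · cases h1; cases h3; rfl
    · cases h3

/-- Replica `i` has answered the query with tag `tag` of client `c` before time `t`, with a
timestamp of at most `τ`. -/
def Answered (E : Trace (impl n P)) (t c tag : ℕ) (i : Fin n) (τ : ℕ ×ₗ ℕ) : Prop :=
  ∃ b b', b' < b ∧ b < t ∧ (cl E b' c).tag = tag ∧ (P.strict = true → fr E (b + 1) i = true) ∧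
    (sv E (b + 1) i).ts ≤ τ

theorem Answered.mono {t t' c tag : ℕ} {i : Fin n} {τ τ' : ℕ ×ₗ ℕ} (h : Answered E t c tag i τ)
    (ht : t ≤ t') (hτ : τ ≤ τ') : Answered E t' c tag i τ' := by
  obtain ⟨b, b', h1, h2, h3, h4, h5⟩ := h
  exact ⟨b, b', h1, h2.trans_le ht, h3, h4, h5.trans hτ⟩

/-- The query quorum `Q` is no longer part of the client's state during the store phase, hence the
existential. The strict bounds on `acks.card` serve wait freedom: a phase ends as soon as its quorum
is reached. -/
def QuorumInv (E : Trace (impl n P)) (t c : ℕ) : Prop :=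
  match (cl E t c).phase with
  | .idle => True
  | .query _ acks best => acks.card < P.readQ ∧ ∀ i ∈ acks, Answered E t c (cl E t c).tag i best.ts
  | .store op acks x =>
      (∃ (Q : Finset (Fin n)) (best : Stamped V), P.readQ ≤ Q.card ∧ x = choose c op best ∧
        ∀ i ∈ Q, Answered E t c (cl E t c).tag i best.ts) ∧
      acks.card < P.writeQ ∧ ∀ i ∈ acks, ∃ a < t, x.ts ≤ (sv E (a + 1) i).ts

/-- Each phase starts with no answers, so positive quorum sizes are what makes the strict bounds
true initially. -/
theorem quorumInv (hr : 0 < P.readQ) (hw : 0 < P.writeQ) (hE : E.IsExecution m) (t c : ℕ) :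
    QuorumInv E t c := by
  induction t with
  | zero => simp [QuorumInv, cl, hE.1]
  | succ t ih =>
    have keep : (cl E (t + 1) c) = cl E t c → QuorumInv E (t + 1) c := by
      intro h
      unfold QuorumInv at ih ⊢
      rw [h]
      rcases hcl : cl E t c with ⟨tag', _ | ⟨op, acks, best⟩ | ⟨op, acks, x⟩⟩ <;> rw [hcl] at ih
      · trivial
      · exact ⟨ih.1, fun i hi => (ih.2 i hi).mono t.le_succ le_rfl⟩
      · obtain ⟨⟨Q, best, h1, h2, h3⟩, h4, h5⟩ := ih
        refine ⟨⟨Q, best, h1, h2, fun i hi => (h3 i hi).mono t.le_succ le_rfl⟩, h4, ?_⟩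
        exact fun i hi => (h5 i hi).imp fun a ha => ⟨ha.1.trans t.lt_succ_self, ha.2⟩
    rcases client_cases hE t c with h | ⟨op, -, -, -, h⟩ | ⟨s, j, i, tag, y, f, -, hs, he, h, -⟩
    · exact keep h.1.1
    · simp [QuorumInv, h, hr]
    · obtain ⟨b, hb, rfl, rfl, b', hb', htag⟩ := reply_spec hE ⟨s, hs, List.mem_of_getElem? he⟩
      rcases hcl : cl E t c with ⟨tag', _ | ⟨op, acks, best⟩ | ⟨op, acks, x⟩⟩
      · rw [hcl] at h
        exact keep (h.trans hcl.symm)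
      · unfold QuorumInv at ih
        rw [hcl] at ih h
        simp only [handle] at h
        simp only at ih
        by_cases hc : tag = tag' ∧ (P.strict = true → fr E (b + 1) i = true)
        · rw [if_pos hc] at h
          have key : ∀ i' ∈ insert i acks, Answered E (t + 1) c tag' i'
              (best.merge (sv E (b + 1) i)).ts := by
            intro i' hi'
            rcases Finset.mem_insert.mp hi' with rfl | hi'
            · exact ⟨b, b', hb', by omega, htag.trans hc.1, hc.2, Stamped.le_merge_right ..⟩
            · exact (ih.2 i' hi').mono t.le_succ (Stamped.le_merge_left ..)
          split_ifs at h with hq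
          · unfold QuorumInv
            rw [h]
            exact ⟨⟨_, _, hq, rfl, key⟩, by simpa using hw, by simp⟩
          · unfold QuorumInv
            rw [h]
            exact ⟨not_le.mp hq, key⟩
        · rw [if_neg hc] at h
          exact keep (h.trans hcl.symm)
      · unfold QuorumInv at ih
        rw [hcl] at ih h
        simp only [handle] at h
        simp only at ih
        obtain ⟨⟨Q, best, h1, h2, h3⟩, h4, h5⟩ := ih
        split_ifs at h with hc hq
        · simp [QuorumInv, h]
        · unfold QuorumInv
          rw [h]
          refine ⟨⟨Q, best, h1, h2, fun i hi => (h3 i hi).mono t.le_succ le_rfl⟩,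
            not_le.mp hq, fun i' hi' => ?_⟩
          rcases Finset.mem_insert.mp hi' with rfl | hi'
          · exact ⟨b, by omega, hc⟩
          · exact (h5 i' hi').imp fun a ha => ⟨ha.1.trans t.lt_succ_self, ha.2⟩
        · exact keep (h.trans hcl.symm)

/-- A set flag at `t'` excludes every earlier restart, and without restarts the storage only changes
by merging. Nothing is assumed about rollbacks, which may still happen after `t'`. -/
theorem fresh_anti (hE : E.IsExecution m) {t t' : ℕ} (ht : t ≤ t') (i : Fin n)
    (h : fr E t' i = true) : fr E t i = true ∧ (sv E t i).ts ≤ (sv E t' i).ts := by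
  induction ht with
  | refl => exact ⟨h, le_rfl⟩
  | @step t' _ ih =>
    rcases replica_cases hE t' i with ⟨h', -⟩ | ⟨src, tag, y, -, -, h'⟩ | ⟨s, -, -, h'⟩
    · simp only [sv, fr, h'] at h ih ⊢
      exact ih h
    · simp only [sv, fr, h'] at h ih ⊢
      exact ⟨(ih h).1, (ih h).2.trans (Stamped.le_merge_left ..)⟩
    · simp [fr, h'] at h

theorem sv_mono (hE : E.IsExecution m) {i : Fin n} (hi : ¬ E.RollsBack i) {t t' : ℕ}
    (ht : t ≤ t') : (sv E t i).ts ≤ (sv E t' i).ts := by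
  induction ht with
  | refl => exact le_rfl
  | @step t' _ ih =>
    refine ih.trans ?_
    rcases replica_cases hE t' i with ⟨h', -⟩ | ⟨src, tag, y, -, -, h'⟩ | ⟨s, hs, hev, h'⟩
    · simp only [sv, h', le_refl]
    · simp only [sv, h']
      exact Stamped.le_merge_left ..
    · simp only [sv, h']
      by_contra hne
      -- The restored version `s` itself serves as the witness: if its timestamp is below the
      -- current one, the content has been modified since.
      refine hi ⟨t', s, hev, s, le_rfl, hs, fun heq => hne ?_⟩
      exact (congrArg Stamped.ts heq).ge

/-- Any two quorums intersect in a replica that can be relied upon. -/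
def Intersecting (E : Trace (impl n P)) : Prop :=
  ∀ A Q : Finset (Fin n), P.writeQ ≤ A.card → P.readQ ≤ Q.card →
    ∃ i ∈ A, i ∈ Q ∧ (P.strict = true ∨ ¬ E.RollsBack i)

theorem Chosen.spec (hr : 0 < P.readQ) (hw : 0 < P.writeQ) (hE : E.IsExecution m)
    {o c : ℕ} {op : Op V} {x : Stamped V} (h : Chosen E o c op x) :
    ∃ (Q : Finset (Fin n)) (best : Stamped V) (t : ℕ), P.readQ ≤ Q.card ∧ x = choose c op best ∧
      ∀ i ∈ Q, Answered E t c ((cl E o c).tag + 1) i best.ts := by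
  obtain ⟨-, t, acks, -, h⟩ := h
  have := quorumInv hr hw hE t c
  unfold QuorumInv at this
  rw [h] at this
  obtain ⟨⟨Q, best, h1⟩, -⟩ := this
  exact ⟨Q, best, t, h1⟩

theorem ts_lt_choose_write (c : ℕ) (v : V) (x : Stamped V) :
    x.ts < (choose c (.write v) x).ts := by
  simp only [choose, Prod.Lex.lt_iff]
  left; simp

theorem choose_ts_le (c : ℕ) (op : Op V) (x : Stamped V) : x.ts ≤ (choose c op x).ts := by
  rcases op with _ | v
  · exact le_rfl
  · exact (ts_lt_choose_write c v x).le

theorem Chosen.of_completes (hE : E.IsExecution m) {o t c : ℕ} {op : Op V} {ρ : Resp V}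
    (hev : E.ev o = .invoke c op) (h : E.Completes o t ρ) :
    ∃ x, Chosen E o c op x ∧ ρ = response op x := by
  obtain ⟨hot, acks, x, -, -, -, -, h1, h2, -⟩ := completes_spec hE hev h
  exact ⟨x, ⟨hev, t, acks, hot, h1⟩, h2⟩

/-- A replica common to the store quorum of `o₁` and the query quorum of `o₂` held at least `x₁.ts`
at a time before `t`, and answered the query after `o₂ > t`. Its timestamp has not dropped in
between, either because it was still fresh or because it never rolls back. -/
theorem Chosen.le_of_completes (hr : 0 < P.readQ) (hw : 0 < P.writeQ) (hE : E.IsExecution m)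
    (hI : Intersecting E) {o₁ o₂ c₁ c₂ t : ℕ} {op₁ op₂ : Op V} {x₁ x₂ : Stamped V} {ρ : Resp V}
    (h₁ : Chosen E o₁ c₁ op₁ x₁) (hc : E.Completes o₁ t ρ) (ht : t < o₂)
    (h₂ : Chosen E o₂ c₂ op₂ x₂) :
    x₁.ts ≤ x₂.ts ∧ ∀ v, op₂ = .write v → x₁.ts < x₂.ts := by
  obtain ⟨hot, acks, x, i₀, tag, y, f, hcl, -, hA, hy, hs⟩ := completes_spec hE h₁.1 hc
  obtain rfl : x = x₁ := Chosen.unique hE ⟨h₁.1, t, acks, hot, hcl⟩ h₁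
  obtain ⟨Q, best, t₂, hQ, rfl, hans⟩ := h₂.spec hr hw hE
  suffices hle : x.ts ≤ best.ts by
    refine ⟨hle.trans (choose_ts_le ..), ?_⟩
    rintro v rfl
    exact hle.trans_lt (ts_lt_choose_write ..)
  obtain ⟨i, hiA, hiQ, hi⟩ := hI _ _ hA hQ
  -- The reply that completes the quorum arrives together with the response, so it is not covered by
  -- the invariant at time `t` and is treated separately.
  have hack : ∃ a < t, x.ts ≤ (sv E (a + 1) i).ts := by
    rcases Finset.mem_insert.mp hiA with rfl | hiA
    · obtain ⟨b, hb, rfl, -⟩ := reply_spec hE hs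
      exact ⟨b, hb, hy⟩
    · have := quorumInv hr hw hE t c₁
      unfold QuorumInv at this
      rw [hcl] at this
      exact this.2.2 i hiA
  obtain ⟨a, ha, hxa⟩ := hack
  obtain ⟨b, b', hb', -, htag, hfr, hb⟩ := hans i hiQ
  -- Client `c₂` carries the tag of this operation only after invoking it.
  have hob : o₂ < b' := by
    by_contra hle
    have := tag_mono hE (not_lt.mp hle) c₂
    omega
  refine hxa.trans (le_trans ?_ hb)
  rcases hi with hi | hi
  · exact (fresh_anti hE (by omega) i (hfr hi)).2
  · exact sv_mono hE hi (by omega)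

/-! ### Linearizability -/

open Classical in
/-- The timestamp chosen by the operation invoked at time `o`. -/
noncomputable def stamp (E : Trace (impl n P)) (o : ℕ) : ℕ ×ₗ ℕ :=
  if h : ∃ x c op, Chosen E o c op x then h.choose.ts else toLex (0, 0)

open Classical in
/-- `1` if a read is invoked at time `o`, and `0` otherwise. -/
noncomputable def readBit (E : Trace (impl n P)) (o : ℕ) : ℕ :=
  if ∃ c, E.ev o = .invoke c .read then 1 else 0

/-- Operations are linearized in the order of their timestamps, writes before reads. -/
noncomputable def linKey (E : Trace (impl n P)) (o : ℕ) : (ℕ ×ₗ ℕ) ×ₗ (ℕ ×ₗ ℕ) :=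
  toLex (stamp E o, toLex (readBit E o, o))

theorem Chosen.stamp_eq (hE : E.IsExecution m) {o c : ℕ} {op : Op V} {x : Stamped V}
    (h : Chosen E o c op x) : stamp E o = x.ts := by
  have h' : ∃ x c op, Chosen E o c op x := ⟨x, c, op, h⟩
  rw [stamp, dif_pos h']
  obtain ⟨c', op', hc⟩ := h'.choose_spec
  rw [hc.unique hE h]

theorem linKey_lt_iff {o o' : ℕ} :
    linKey E o < linKey E o' ↔ stamp E o < stamp E o' ∨ stamp E o = stamp E o' ∧
      (readBit E o < readBit E o' ∨ readBit E o = readBit E o' ∧ o < o') := by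
  simp only [linKey, Prod.Lex.lt_iff, ofLex_toLex]

theorem readBit_read {o c : ℕ} (h : E.ev o = .invoke c .read) : readBit E o = 1 := if_pos ⟨_, h⟩

theorem readBit_write {o c : ℕ} {v : V} (h : E.ev o = .invoke c (.write v)) : readBit E o = 0 :=
  if_neg (by rw [h]; simp)

/-- The timestamp of a write contains its client, so a tie means one and the same client. Its
operations are sequential, and `Chosen.le_of_completes` makes the timestamps of successive writes
strictly increase. -/
theorem Chosen.write_inj (hr : 0 < P.readQ) (hw : 0 < P.writeQ) (hE : E.IsExecution m)
    (hI : Intersecting E) {o o' c c' : ℕ} {v v' : V} {x x' : Stamped V}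
    (h : Chosen E o c (.write v) x) (h' : Chosen E o' c' (.write v') x') (hx : x.ts = x'.ts) :
    o = o' := by
  obtain ⟨-, b, -, -, rfl, -⟩ := h.spec hr hw hE
  obtain ⟨-, b', -, -, rfl, -⟩ := h'.spec hr hw hE
  obtain rfl : c = c' := congrArg (fun z => (ofLex z).2) hx
  rcases lt_trichotomy o o' with hlt | hlt | hlt
  · obtain ⟨t, ht, ρ, hc⟩ := completes_of_lt hE h.1 h'.1 hlt
    exact absurd hx ((h.le_of_completes hr hw hE hI hc ht h').2 _ rfl).ne
  · exact hlt
  · obtain ⟨t, ht, ρ, hc⟩ := completes_of_lt hE h'.1 h.1 hlt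
    exact absurd hx.symm ((h'.le_of_completes hr hw hE hI hc ht h).2 _ rfl).ne

/-- All operations that have chosen a timestamp are linearized, including incomplete ones, whose
values may already have been read. A read with a non-initial value shares its timestamp with exactly
one write; `linKey` puts that write before the read and after all writes with smaller timestamps. -/
theorem linearizable (hr : 0 < P.readQ) (hw : 0 < P.writeQ) (hE : E.IsExecution m)
    (hI : Intersecting E) : E.Linearizable P.v₀ := by
  classical
  refine ⟨?_, {o | ∃ x c op, Chosen E o c op x}, fun o o' => linKey E o < linKey E o',
    ?_, ?_, ?_, ?_, ?_, ?_, ?_, ?_⟩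
  · intro t c ρ h
    obtain ⟨o, op, -, hev, hc, -⟩ := completes_of_resp hE h
    exact ⟨o, op, hev, hc⟩
  · rintro o ⟨x, c, op, h⟩
    exact ⟨c, op, h.1⟩
  · intro o t ρ h
    obtain ⟨c, op, hev, -⟩ := id h
    obtain ⟨x, hx, -⟩ := Chosen.of_completes hE hev h
    exact ⟨x, c, op, hx⟩
  · exact fun o _ => lt_irrefl _
  · exact fun _ _ _ _ _ _ => lt_trans
  · intro o _ o' _ hne
    refine lt_or_gt_of_ne fun h => hne ?_
    exact congrArg (fun z => (ofLex (ofLex z).2).2) h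
  · rintro o₁ ⟨x₁, c₁, op₁, h₁⟩ o₂ ⟨x₂, c₂, op₂, h₂⟩ t ρ hc ht
    obtain ⟨hle, hlt⟩ := h₁.le_of_completes hr hw hE hI hc ht h₂
    rw [linKey_lt_iff, h₁.stamp_eq hE, h₂.stamp_eq hE]
    rcases hle.lt_or_eq with hl | heq
    · exact .inl hl
    refine .inr ⟨heq, ?_⟩
    have ho : o₁ < o₂ := by
      obtain ⟨-, -, -, h3, -⟩ := hc
      omega
    -- A tie is possible only if the later operation is a read. Then `readBit` or, between two
    -- reads, the invocation time orders them correctly.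
    rcases op₂ with _ | v₂
    · rw [readBit_read h₂.1]
      unfold readBit
      split_ifs <;> simp [ho]
    · exact absurd heq (hlt _ rfl).ne
  · intro o c v t ρ hev hc
    obtain ⟨x, hx, rfl⟩ := Chosen.of_completes hE hev hc
    rfl
  · intro o c t ρ hev hc
    obtain ⟨x, hx, rfl⟩ := Chosen.of_completes hE hev hc
    refine ⟨x.val, rfl, ?_⟩
    obtain ⟨-, t', acks, hot', hcl⟩ := id hx
    rcases (provided hE t').2.1 c x (by rw [hcl]; rfl) with h0 | ⟨cw, v, s, acks', -, hs⟩
    · left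
      refine ⟨by rw [h0]; rfl, ?_⟩
      rintro w ⟨xw, cw, opw, hwc⟩ c' v' hw' hlt
      have heq := hwc.1
      rw [hw'] at heq; cases heq
      rw [linKey_lt_iff, hwc.stamp_eq hE, hx.stamp_eq hE] at hlt
      obtain ⟨-, b, -, -, hxw, -⟩ := hwc.spec hr hw hE
      -- Every write increments the number in the timestamp, so none is ordered before a read that
      -- keeps the initial timestamp.
      have hpos : (P.init).ts < xw.ts := by
        rw [hxw]
        simp only [choose, Prod.Lex.lt_iff, Params.init]
        left; simp
      rw [h0] at hlt
      rcases hlt with hlt | hlt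
      · exact lt_asymm hlt hpos
      · exact hpos.ne' hlt.1
    · right
      obtain ⟨w, hws, hwev, htag⟩ := exists_invoke hE (t := s) (c := cw) (op := .write v)
        (by rw [hs]; rfl)
      have hwc : Chosen E w cw (.write v) x :=
        ⟨hwev, s, acks', hws, by rw [htag, ← hs]⟩
      obtain ⟨-, b, -, -, hxw, -⟩ := hwc.spec hr hw hE
      refine ⟨w, ⟨x, cw, _, hwc⟩, cw, by rw [hxw]; exact hwev, ?_, ?_⟩
      · show linKey E _ < linKey E _
        rw [linKey_lt_iff, readBit_write hwev, readBit_read hev, hwc.stamp_eq hE, hx.stamp_eq hE]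
        simp
      · rintro w' ⟨x', c', op', hwc'⟩ c'' v'' hev' hlt
        have heq := hwc'.1
        rw [hev'] at heq; cases heq
        rw [linKey_lt_iff, readBit_write hev', readBit_read hev, hwc'.stamp_eq hE, hx.stamp_eq hE] at hlt
        rcases hlt with hlt | hlt
        · right
          show linKey E _ < linKey E _
          rw [linKey_lt_iff, hwc'.stamp_eq hE, hwc.stamp_eq hE]
          exact .inl hlt
        · left
          exact hwc'.write_inj hr hw hE hI hwc hlt.1

/-! ### Wait freedom -/

theorem tick_sends (hE : E.IsExecution m) {t c : ℕ} {x : Stamped V}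
    (hev : E.ev t = .tick (.inr c)) (hx : (cl E t c).phase.payload = some x) (i : Fin n) :
    ∃ j : ℕ, (E.sends t)[j]? = some ⟨.inr c, .inl i, .request (cl E t c).tag x⟩ := by
  have h := hE.2 t
  unfold Trace.StepAt at h
  rw [hev] at h
  obtain ⟨-, -, a, ha, -, h2, -⟩ := h
  simp only [impl, Set.mem_singleton_iff] at ha
  subst ha
  apply List.mem_iff_getElem?.mp
  rw [h2]
  simp only [clientStep, hx, List.mem_map]
  exact ⟨(.inl i, _), List.mem_map.mpr ⟨i, List.mem_finRange i, rfl⟩, rfl⟩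

theorem deliver_request (hE : E.IsExecution m) {t s j c tag : ℕ} {i : Fin n} {x : Stamped V}
    (hev : E.ev t = .deliver s j)
    (he : (E.sends s)[j]? = some ⟨.inr c, .inl i, .request tag x⟩) :
    s < t ∧ x.ts ≤ (sv E (t + 1) i).ts ∧ (E.sends t)[0]? =
      some ⟨.inl i, .inr c, .reply tag (sv E (t + 1) i) (fr E (t + 1) i)⟩ := by
  have h := hE.2 t
  unfold Trace.StepAt at h
  rw [hev] at h
  obtain ⟨hs, -, e, he', -, -, h⟩ := h
  rw [he] at he'; cases he'
  obtain ⟨a, ha, h1, h2, -⟩ := h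
  simp only [impl, Set.mem_singleton_iff] at ha
  subst ha
  refine ⟨hs, ?_, ?_⟩
  · simp only [sv, h1, replicaStep, Function.update_self]
    exact Stamped.le_merge_right ..
  · simp [sv, fr, h1, h2, replicaStep]

theorem deliver_reply (hE : E.IsExecution m) {t s j c tag : ℕ} {i : Fin n} {y : Stamped V}
    {f : Bool} (hev : E.ev t = .deliver s j)
    (he : (E.sends s)[j]? = some ⟨.inl i, .inr c, .reply tag y f⟩) :
    s < t ∧ cl E (t + 1) c = (handle P c (cl E t c) i tag y f).1 := by
  have h := hE.2 t
  unfold Trace.StepAt at h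
  rw [hev] at h
  obtain ⟨hs, -, e, he', -, -, h⟩ := h
  rw [he] at he'; cases he'
  obtain ⟨a, ha, h1, -, -⟩ := h
  simp only [impl, Set.mem_singleton_iff] at ha
  subst ha
  exact ⟨hs, by simp [cl, h1, clientStep]⟩

/-- A client that remains in one operation receives a reply of every replica that is eventually
up. -/
theorem round_trip (hE : E.IsExecution m) (hF : E.Fair m) {c : ℕ} (hm : c < m)
    (hc : ¬ E.Crashes (.inr c)) {i : Fin n} (hi : E.EventuallyUp (.inl i)) (T : ℕ)
    (hT : ∀ t, T ≤ t → ∃ x, (cl E t c).phase.payload = some x) :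
    ∃ t₁ t₂ t₃ x y f, T ≤ t₁ ∧ t₁ < t₂ ∧ t₂ < t₃ ∧ (cl E t₁ c).phase.payload = some x ∧
      x.ts ≤ y.ts ∧ f = fr E (t₂ + 1) i ∧
      cl E (t₃ + 1) c = (handle P c (cl E t₃ c) i (cl E t₁ c).tag y f).1 := by
  obtain ⟨U, hU⟩ := hi
  have hup := Trace.upFrom_of_not_crashes hE hc
  have hup' : E.UpFrom (.inr c) U := fun t _ => hup t (Nat.zero_le t)
  obtain ⟨t₁, ht₁, hev₁⟩ := hF.1 (.inr c) hm ⟨0, hup⟩ (max T U)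
  have h1T := (le_max_left T U).trans ht₁
  have h1U := (le_max_right T U).trans ht₁
  obtain ⟨x, hx⟩ := hT t₁ h1T
  obtain ⟨j, hj⟩ := tick_sends hE hev₁ hx i
  obtain ⟨t₂, hev₂⟩ := hF.2 U t₁ j _ hj trivial hup' hU h1U
  obtain ⟨h12, hxy, hs⟩ := deliver_request hE hev₂ hj
  obtain ⟨t₃, hev₃⟩ := hF.2 U t₂ 0 _ hs hm hU hup' (h1U.trans h12.le)
  obtain ⟨h23, h⟩ := deliver_reply hE hev₃ hs
  exact ⟨t₁, t₂, t₃, x, _, _, h1T, h12, h23, hx, hxy, rfl, h⟩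

theorem fresh_of_not_crashes (hE : E.IsExecution m) {i : Fin n} (hi : ¬ E.Crashes (.inl i))
    (t : ℕ) : fr E t i = true := by
  induction t with
  | zero => simp [fr, hE.1]
  | succ t ih =>
    rcases replica_cases hE t i with ⟨h', -⟩ | ⟨src, tag, y, -, -, h'⟩ | ⟨s, hs, hev, h'⟩
    · simp only [fr, h']; exact ih
    · simp only [fr, h']; exact ih
    · have h := hE.2 t
      unfold Trace.StepAt at h
      rw [hev] at h
      simp [Trace.upFrom_of_not_crashes hE hi t (Nat.zero_le t)] at h

theorem exists_common_time {α : Type*} (S : Finset α) {p : α → ℕ → Prop}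
    (h : ∀ a ∈ S, ∃ T, ∀ t, T ≤ t → p a t) : ∃ T, ∀ t, T ≤ t → ∀ a ∈ S, p a t := by
  have : ∀ᶠ t in Filter.atTop, ∀ a ∈ S, p a t :=
    (Filter.eventually_all_finset S).mpr fun a ha => Filter.eventually_atTop.mpr (h a ha)
  exact Filter.eventually_atTop.mp this

/-- Enough replicas reply forever. -/
def Available (E : Trace (impl n P)) : Prop :=
  (∃ S : Finset (Fin n), P.writeQ ≤ S.card ∧ ∀ i ∈ S, E.EventuallyUp (.inl i)) ∧
  ∃ S : Finset (Fin n), P.readQ ≤ S.card ∧ ∀ i ∈ S, E.EventuallyUp (.inl i) ∧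
    (P.strict = true → ¬ E.Crashes (.inl i))

/-- In an endless query each available replica completes a round trip within the phase and stays
recorded. Eventually `acks` contains a whole quorum, against the strict bound in `QuorumInv`. -/
theorem query_ends (hr : 0 < P.readQ) (hw : 0 < P.writeQ) (hE : E.IsExecution m) (hF : E.Fair m)
    (hA : Available E) {c : ℕ} (hm : c < m) (hc : ¬ E.Crashes (.inr c)) {T tag : ℕ} {op : Op V} :
    ¬ ∀ t, T ≤ t → ∃ acks best, cl E t c = ⟨tag, .query op acks best⟩ := by
  intro hT
  obtain ⟨-, S, hS, hup⟩ := hA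
  choose! acks best hcl using hT
  have hmono : ∀ {t t'}, T ≤ t → t ≤ t' → acks t ⊆ acks t' := by
    intro t t' h1 h2
    have := client_le hE h2 c
    rw [hcl t h1, hcl t' (h1.trans h2)] at this
    rcases this with h | h
    · exact absurd h (lt_irrefl _)
    · exact h.2.2
  obtain ⟨U, hU⟩ := exists_common_time S (p := fun i t => T ≤ t ∧ i ∈ acks t) <| by
    intro i hi
    obtain ⟨t₁, t₂, t₃, x, y, f, h1, h2, h3, -, -, rfl, h⟩ := round_trip hE hF hm hc (hup i hi).1 T
      fun t ht => ⟨best t ht, by rw [hcl t ht]; rfl⟩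
    rw [hcl _ (by omega), hcl t₁ h1, hcl t₃ (by omega)] at h
    simp only [handle] at h
    rw [if_pos ⟨trivial, fun hs => fresh_of_not_crashes hE ((hup i hi).2 hs) _⟩] at h
    split_ifs at h
    · simp at h
    · refine ⟨t₃ + 1, fun t ht => ⟨by omega, hmono (by omega) ht ?_⟩⟩
      simp only [Client.mk.injEq, Phase.query.injEq, true_and] at h
      rw [h.1]
      exact Finset.mem_insert_self ..
  rcases S.eq_empty_or_nonempty with rfl | ⟨i, hi⟩
  · simp at hS; omega
  have hTU := (hU U le_rfl i hi).1
  have := quorumInv hr hw hE U c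
  unfold QuorumInv at this
  rw [hcl U hTU] at this
  have := Finset.card_le_card fun i hi => (hU U le_rfl i hi).2
  simp only at *
  omega

/-- As for queries. The replies are accepted because a replica merges the request before answering,
so it reports at least `x.ts`, even if it has restarted. -/
theorem store_ends (hr : 0 < P.readQ) (hw : 0 < P.writeQ) (hE : E.IsExecution m) (hF : E.Fair m)
    (hA : Available E) {c : ℕ} (hm : c < m) (hc : ¬ E.Crashes (.inr c)) {T tag : ℕ} {op : Op V}
    {x : Stamped V} :
    ¬ ∀ t, T ≤ t → ∃ acks, cl E t c = ⟨tag, .store op acks x⟩ := by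
  intro hT
  obtain ⟨⟨S, hS, hup⟩, -⟩ := hA
  choose! acks hcl using hT
  have hmono : ∀ {t t'}, T ≤ t → t ≤ t' → acks t ⊆ acks t' := by
    intro t t' h1 h2
    have := client_le hE h2 c
    rw [hcl t h1, hcl t' (h1.trans h2)] at this
    rcases this with h | h
    · exact absurd h (lt_irrefl _)
    · exact h.2.2.1
  obtain ⟨U, hU⟩ := exists_common_time S (p := fun i t => T ≤ t ∧ i ∈ acks t) <| by
    intro i hi
    obtain ⟨t₁, t₂, t₃, x', y, f, h1, h2, h3, hx', hxy, rfl, h⟩ := round_trip hE hF hm hc (hup i hi) T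
      fun t ht => ⟨x, by rw [hcl t ht]; rfl⟩
    rw [hcl t₁ h1] at hx'
    obtain rfl : x = x' := by simpa [Phase.payload] using hx'
    rw [hcl _ (by omega), hcl t₁ h1, hcl t₃ (by omega)] at h
    simp only [handle] at h
    rw [if_pos hxy] at h
    split_ifs at h
    · simp at h
    · refine ⟨t₃ + 1, fun t ht => ⟨by omega, hmono (by omega) ht ?_⟩⟩
      simp only [Client.mk.injEq, Phase.store.injEq, true_and, and_true] at h
      rw [h]
      exact Finset.mem_insert_self ..
  rcases S.eq_empty_or_nonempty with rfl | ⟨i, hi⟩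
  · simp at hS; omega
  have hTU := (hU U le_rfl i hi).1
  have := quorumInv hr hw hE U c
  unfold QuorumInv at this
  rw [hcl U hTU] at this
  have := Finset.card_le_card fun i hi => (hU U le_rfl i hi).2
  simp only at *
  omega

theorem Client.Le.eq_of_op {s s' : Client n V} (h : s.Le s') (ht : s'.tag ≤ s.tag) {op : Op V}
    (ho : s.phase.op? = some op) (hi : s'.phase.op? ≠ none) : s'.phase.op? = some op := by
  rcases h with h | ⟨-, h⟩
  · omega
  · rcases s with ⟨_, _ | _ | _⟩ <;> rcases s' with ⟨_, _ | _ | _⟩ <;>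
      simp_all [Phase.op?, Phase.Le]

theorem handle_active (c : ℕ) (s : Client n V) (i : Fin n) (tag : ℕ) (y : Stamped V) (f : Bool)
    (h : (handle P c s i tag y f).2 = none) (ho : s.phase.op? ≠ none) :
    (handle P c s i tag y f).1.phase.op? ≠ none := by
  rcases s with ⟨_, _ | ⟨op, acks, best⟩ | ⟨op, acks, x⟩⟩
  · exact ho
  · simp only [handle]
    split_ifs <;> simp [Phase.op?]
  · simp only [handle] at h ⊢
    split_ifs at h ⊢ <;> simp_all [Phase.op?]

/-- An operation that never returns keeps its tag forever. It either enters the store phase and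
remains there with one value, or it queries forever; both are excluded. -/
theorem waitFree (hr : 0 < P.readQ) (hw : 0 < P.writeQ) (hE : E.IsExecution m) (hF : E.Fair m)
    (hA : Available E) : E.WaitFree := by
  intro o c op hev hc
  by_contra hno
  have hm : c < m := by
    have h := hE.2 o
    unfold Trace.StepAt at h
    rw [hev] at h
    exact h.1
  have hnr : ∀ t, o ≤ t → ∀ ρ, E.resp t ≠ some (c, ρ) := by
    classical
    intro t ht ρ h
    have hex : ∃ t, o ≤ t ∧ ∃ ρ, E.resp t = some (c, ρ) := ⟨t, ht, ρ, h⟩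
    obtain ⟨h1, ρ, h2⟩ := Nat.find_spec hex
    exact hno ⟨_, ρ, c, op, hev, h1, h2, fun t' h3 h4 ρ' h5 => Nat.find_min hex h4 ⟨h3, ρ', h5⟩⟩
  have hact : ∀ t, o < t → (cl E t c).tag = (cl E o c).tag + 1 ∧ (cl E t c).phase.op? = some op := by
    intro t ht
    induction t, Nat.succ_le_of_lt ht using Nat.le_induction with
    | base => rw [Nat.succ_eq_add_one, (invoke_spec hE hev).2.2]; exact ⟨rfl, rfl⟩
    | succ t ht' ih =>
      obtain ⟨ih1, ih2⟩ := ih ht'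
      rcases client_cases hE t c with h | ⟨op', h1, h2, -⟩ | ⟨s, j, i, tag, y, f, -, -, -, h, h'⟩
      · rw [h.1.1]; exact ⟨ih1, ih2⟩
      · exact absurd ⟨o, op, ht', hev, fun t' h3 _ => hnr t' h3⟩ h2
      · rw [h]
        refine ⟨by rw [handle_tag, ih1], (le_handle ..).eq_of_op (by rw [handle_tag]) ih2 ?_⟩
        have hn := fun ρ => hnr t (Nat.le_of_succ_le ht') ρ
        simp only [h', Ne, Option.map_eq_some_iff] at hn
        refine handle_active _ _ _ _ _ _ ?_ (by rw [ih2]; simp)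
        rcases hρ : (handle P c (cl E t c) i tag y f).2 with _ | ρ
        · rfl
        · exact absurd ⟨ρ, hρ, rfl⟩ (hn ρ)
  by_cases hch : ∃ x, Chosen E o c op x
  · obtain ⟨x, -, T, acks, hoT, hT⟩ := hch
    refine store_ends hr hw hE hF hA hm hc (T := T) (tag := (cl E o c).tag + 1) (op := op) (x := x)
      fun t ht => ?_
    have h1 := client_le hE ht c
    obtain ⟨h2, h3⟩ := hact t (by omega)
    rw [hT] at h1
    rcases hcl : cl E t c with ⟨_, _ | _ | _⟩ <;> rw [hcl] at h1 h2 h3 <;>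
      simp_all [Phase.op?, Phase.Le, Client.Le]
  · refine query_ends hr hw hE hF hA hm hc (T := o + 1) (tag := (cl E o c).tag + 1) (op := op)
      fun t ht => ?_
    obtain ⟨h2, h3⟩ := hact t ht
    rcases hcl : cl E t c with ⟨_, _ | ⟨op', acks, best⟩ | ⟨op', acks, x⟩⟩ <;>
      rw [hcl] at h2 h3
    · simp [Phase.op?] at h3
    · simp only [Phase.op?, Option.some.injEq] at h2 h3
      subst h2 h3
      exact ⟨_, _, rfl⟩
    · simp only [Phase.op?, Option.some.injEq] at h2 h3
      subst h2 h3
      exact absurd ⟨x, hev, t, acks, ht, hcl⟩ hch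

/-! ### Tolerance -/

theorem card_compl_ge {S : Set (Fin n)} {k : ℕ} (h : S.ncard ≤ k) :
    ∃ F : Finset (Fin n), n - k ≤ F.card ∧ ∀ i ∈ F, i ∉ S := by
  classical
  refine ⟨Finset.univ.filter (· ∉ S), ?_, by simp⟩
  have h1 := Set.ncard_add_ncard_compl S
  have h2 : (Sᶜ).ncard = (Finset.univ.filter (· ∉ S)).card := by
    rw [← Set.ncard_coe_finset]; congr 1; ext; simp
  simp only [Nat.card_eq_fintype_card, Fintype.card_fin] at h1
  omega

theorem exists_mem_inter {A Q : Finset (Fin n)} {S : Set (Fin n)}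
    (h : n + S.ncard < A.card + Q.card) : ∃ i ∈ A, i ∈ Q ∧ i ∉ S := by
  classical
  by_contra hno
  push Not at hno
  have h1 : ((A ∩ Q : Finset (Fin n)) : Set (Fin n)).ncard ≤ S.ncard :=
    Set.ncard_le_ncard fun i hi => by
      have := Finset.mem_inter.mp (Finset.mem_coe.mp hi)
      exact hno i this.1 this.2
  rw [Set.ncard_coe_finset] at h1
  have h2 := Finset.card_union_add_card_inter A Q
  have h3 := Finset.card_le_univ (A ∪ Q)
  simp only [Fintype.card_fin] at h3
  omega

theorem exists_tolerant (v₀ : V) {k r b : ℕ} (h : 2 * k + min b r + 1 ≤ n) :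
    ∃ A : Implementation n V, IsTolerantRegister A v₀ k r b := by
  rcases le_or_gt r b with hrb | hrb
  · rw [min_eq_right hrb] at h
    -- Two quorums of size `n - k` share at least `n - 2k > r` replicas, more than can roll back.
    refine ⟨impl n ⟨v₀, false, n - k, n - k⟩, fun m E hE ⟨h1, h2, _⟩ => ?_⟩
    obtain ⟨F, hF, hF'⟩ := card_compl_ge h1
    have hup : ∀ i ∈ F, E.EventuallyUp (.inl i) := fun i hi => (not_not.mp (hF' i hi)).1
    refine ⟨linearizable (by simp; omega) (by simp; omega) hE ?_, fun hfair =>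
      waitFree (by simp; omega) (by simp; omega) hE hfair
        ⟨⟨F, hF, hup⟩, F, hF, fun i hi => ⟨hup i hi, by simp⟩⟩⟩
    intro A Q hA hQ
    simp only at hA hQ
    obtain ⟨i, hiA, hiQ, hi⟩ := exists_mem_inter (A := A) (Q := Q) (S := {i | E.RollsBack i})
      (by omega)
    exact ⟨i, hiA, hiQ, .inr hi⟩
  · rw [min_eq_left hrb.le] at h
    refine ⟨impl n ⟨v₀, true, n - k - b, n - k⟩, fun m E hE ⟨h1, _, h3⟩ => ?_⟩
    obtain ⟨F, hF, hF'⟩ := card_compl_ge h1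
    have hup : ∀ i ∈ F, E.EventuallyUp (.inl i) := fun i hi => (not_not.mp (hF' i hi)).1
    have h4 : ({i | ¬ E.Correct i} ∪ {i | E.Benign i}).ncard ≤ k + b :=
      (Set.ncard_union_le _ _).trans (by omega)
    obtain ⟨G, hG, hG'⟩ := card_compl_ge h4
    refine ⟨linearizable (by simp; omega) (by simp; omega) hE ?_, fun hfair =>
      waitFree (by simp; omega) (by simp; omega) hE hfair
        ⟨⟨F, hF, hup⟩, G, (Nat.sub_sub n k b).le.trans hG, fun i hi => ?_⟩⟩
    · intro A Q hA hQ
      simp only at hA hQ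
      obtain ⟨i, hiA, hiQ, hi⟩ := exists_mem_inter (A := A) (Q := Q) (S := ∅) (by simp; omega)
      exact ⟨i, hiA, hiQ, .inl rfl⟩
    · have hi' := hG' i hi
      simp only [Set.mem_union, Set.mem_ofPred_eq, not_or, not_not] at hi'
      exact ⟨hi'.1.1, fun _ hcr => hi'.2 ⟨hi'.1, hcr⟩⟩

end Quorum

/-! ## Executions that follow a schedule -/

/-- The event `x` can be appended at time `t`; restarts do not roll back. Pending operations are not
taken into account. -/
def Trace.Ready {A : Implementation n V} (m : ℕ) (E : Trace A) (t : ℕ) : Event n V → Prop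
  | .idle => True
  | .invoke c _ => c < m ∧ (E.cfg t).up (.inr c) = true
  | .tick p => Present m p ∧ (E.cfg t).up p = true
  | .deliver s j => s < t ∧ (∀ t' < t, E.ev t' ≠ .deliver s j) ∧
      ∃ e, (E.sends s)[j]? = some e ∧ Present m e.dst ∧ (E.cfg t).up e.dst = true
  | .crash p => Present m p ∧ (E.cfg t).up p = true
  | .restart i s => (E.cfg t).up (.inl i) = false ∧ s = t

namespace Simulation

variable {A : Implementation n V}

/-- A global state with the messages sent so far and those delivered so far. -/
structure State (A : Implementation n V) where
  cfg : Config A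
  log : ℕ → List (Envelope A)
  delivered : Set (ℕ × ℕ)

def Enabled (m t : ℕ) (σ : State A) : Event n V → Prop
  | .idle => True
  | .invoke c _ => c < m ∧ σ.cfg.up (.inr c) = true
  | .tick p => Present m p ∧ σ.cfg.up p = true
  | .deliver s j => s < t ∧ (s, j) ∉ σ.delivered ∧
      ∃ e, (σ.log s)[j]? = some e ∧ Present m e.dst ∧ σ.cfg.up e.dst = true
  | .crash p => Present m p ∧ σ.cfg.up p = true
  | .restart i s => σ.cfg.up (.inl i) = false ∧ s = t

abbrev Effect (A : Implementation n V) : Type u :=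
  Config A × List (Envelope A) × Option (ℕ × Resp V)

def replicaEffect (C : Config A) (i : Fin n) (a : (A.Vol × A.NV) × List (Proc n × A.Msg)) :
    Effect A :=
  ({ C with
      replica := Function.update C.replica i a.1
      up := Function.update C.up (.inl i) true },
    a.2.map fun x => ⟨.inl i, x.1, x.2⟩, none)

def clientEffect (C : Config A) (c : ℕ)
    (a : A.CState × List (Proc n × A.Msg) × Option (Resp V)) : Effect A :=
  ({ C with client := Function.update C.client c a.1 },
    a.2.1.map fun x => ⟨.inr c, x.1, x.2⟩, a.2.2.map fun ρ => (c, ρ))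

noncomputable def act (C : Config A) (x : Input n A.Msg) : Proc n → Effect A
  | .inl i => replicaEffect C i (A.replicaStep_nonempty i (C.replica i) x).some
  | .inr c => clientEffect C c (A.clientStep_nonempty c (C.client c) x).some

noncomputable def effect (σ : State A) : Event n V → Effect A
  | .idle => (σ.cfg, [], none)
  | .invoke c op => clientEffect σ.cfg c (A.clientInvoke_nonempty c (σ.cfg.client c) op).some
  | .tick p => act σ.cfg .tick p
  | .deliver s j =>
      match (σ.log s)[j]? with
      | none => (σ.cfg, [], none)
      | some e => act σ.cfg (.receive e.src e.payload) e.dst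
  | .crash p => ({ σ.cfg with up := Function.update σ.cfg.up p false }, [], none)
  | .restart i _ => replicaEffect σ.cfg i (A.onRestart_nonempty i (σ.cfg.replica i).2).some

open Classical in
noncomputable def actual (m t : ℕ) (σ : State A) (x : Event n V) : Event n V :=
  if Enabled m t σ x then x else .idle

noncomputable def next (m : ℕ) (sched : ℕ → Event n V) (t : ℕ) (σ : State A) : State A where
  cfg := (effect σ (actual m t σ (sched t))).1
  log := Function.update σ.log t (effect σ (actual m t σ (sched t))).2.1
  delivered := {x | x ∈ σ.delivered ∨ actual m t σ (sched t) = .deliver x.1 x.2}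

variable (A) in
noncomputable def state (m : ℕ) (sched : ℕ → Event n V) : ℕ → State A
  | 0 => ⟨⟨A.replicaInit, A.clientInit, fun _ => true⟩, fun _ => [], ∅⟩
  | t + 1 => next m sched t (state m sched t)

variable (A) in
noncomputable def trace (m : ℕ) (sched : ℕ → Event n V) : Trace A where
  cfg t := (state A m sched t).cfg
  ev t := actual m t (state A m sched t) (sched t)
  sends t := (effect (state A m sched t) (actual m t (state A m sched t) (sched t))).2.1
  resp t := (effect (state A m sched t) (actual m t (state A m sched t) (sched t))).2.2

variable {m : ℕ} {sched : ℕ → Event n V}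

theorem log_eq {s t : ℕ} (h : s < t) :
    (state A m sched t).log s = (trace A m sched).sends s := by
  induction t, Nat.succ_le_of_lt h using Nat.le_induction with
  | base => simp [state, next, trace]
  | succ t ht ih =>
    rw [← ih ht]
    exact Function.update_of_ne (Nat.ne_of_lt ht) _ _

theorem mem_delivered {t s j : ℕ} :
    (s, j) ∈ (state A m sched t).delivered ↔ ∃ t' < t, (trace A m sched).ev t' = .deliver s j := by
  induction t with
  | zero => simp [state]
  | succ t ih =>
    have : (s, j) ∈ (state A m sched (t + 1)).delivered ↔
        (s, j) ∈ (state A m sched t).delivered ∨ (trace A m sched).ev t = .deliver s j := Iff.rfl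
    rw [this, ih]
    constructor
    · rintro (⟨t', h, h'⟩ | h)
      exacts [⟨t', by omega, h'⟩, ⟨t, by omega, h⟩]
    · rintro ⟨t', h, h'⟩
      rcases Nat.lt_succ_iff_lt_or_eq.mp h with h | rfl
      exacts [.inl ⟨t', h, h'⟩, .inr h']

theorem enabled_iff (t : ℕ) (x : Event n V) :
    Enabled m t (state A m sched t) x ↔ (trace A m sched).Ready m t x := by
  rcases x with _ | _ | _ | ⟨s, j⟩ | _ | _ <;> try exact Iff.rfl
  simp only [Enabled, Trace.Ready, mem_delivered]
  constructor
  · rintro ⟨hs, h1, h2⟩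
    rw [log_eq hs] at h2
    exact ⟨hs, fun t' ht h => h1 ⟨t', ht, h⟩, h2⟩
  · rintro ⟨hs, h1, h2⟩
    rw [log_eq hs]
    exact ⟨hs, fun ⟨t', ht, h⟩ => h1 t' ht h, h2⟩

theorem ev_of_ready {t : ℕ} (h : (trace A m sched).Ready m t (sched t)) :
    (trace A m sched).ev t = sched t :=
  if_pos ((enabled_iff t _).mpr h)

theorem ev_cases (t : ℕ) : (trace A m sched).Ready m t (sched t) ∧
    (trace A m sched).ev t = sched t ∨ (trace A m sched).ev t = .idle := by
  by_cases h : Enabled m t (state A m sched t) (sched t)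
  · exact .inl ⟨(enabled_iff t _).mp h, if_pos h⟩
  · exact .inr (if_neg h)

theorem effect_spec (t : ℕ) {x : Event n V} (hx : (trace A m sched).ev t = x) :
    (trace A m sched).cfg (t + 1) = (effect (state A m sched t) x).1 ∧
    (trace A m sched).sends t = (effect (state A m sched t) x).2.1 ∧
    (trace A m sched).resp t = (effect (state A m sched t) x).2.2 := by
  subst hx
  exact ⟨rfl, rfl, rfl⟩

/-- Scheduled events that are not enabled become idle. The one requirement that `Ready` omits is
that no operation of the client is pending, and this is automatic with a single invocation. -/
theorem isExecution (hs : ∀ t t' c c' op op', sched t = .invoke c op → sched t' = .invoke c' op' →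
    t = t') : (trace A m sched).IsExecution m := by
  refine ⟨rfl, fun t => ?_⟩
  rcases ev_cases (A := A) (m := m) (sched := sched) t with ⟨hr, hev⟩ | hev
  · obtain ⟨h1, h2, h3⟩ := effect_spec t hev
    unfold Trace.StepAt
    rw [hev]
    rcases hsch : sched t with _ | ⟨c, op⟩ | p | ⟨s, j⟩ | p | ⟨i, s⟩ <;>
      rw [hsch] at hr h1 h2 h3 <;> simp only
    · exact ⟨h1, h2, h3⟩
    · refine ⟨hr.1, hr.2, ?_, _, Set.Nonempty.some_mem _, h1, h2, h3⟩
      rintro ⟨s, op', hlt, hevs, -⟩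
      rcases ev_cases (A := A) (m := m) (sched := sched) s with ⟨-, h⟩ | h
      · exact hlt.ne (hs s t _ _ _ _ (h.symm.trans hevs) hsch)
      · rw [h] at hevs; cases hevs
    · refine ⟨hr.1, hr.2, ?_⟩
      rcases p with i | c
      · exact ⟨_, Set.Nonempty.some_mem _, h1, h2, h3⟩
      · exact ⟨_, Set.Nonempty.some_mem _, h1, h2, h3⟩
    · obtain ⟨hlt, hnd, e, he, hp, hup⟩ := hr
      refine ⟨hlt, hnd, e, he, hp, hup, ?_⟩
      simp only [effect, log_eq hlt, he] at h1 h2 h3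
      rcases e with ⟨src, i | c, msg⟩
      · exact ⟨_, Set.Nonempty.some_mem _, h1, h2, h3⟩
      · exact ⟨_, Set.Nonempty.some_mem _, h1, h2, h3⟩
    · exact ⟨hr.1, hr.2, h1, h2, h3⟩
    · obtain ⟨hup, rfl⟩ := hr
      exact ⟨hup, le_rfl, _, Set.Nonempty.some_mem _, h1, h2, h3⟩
  · obtain ⟨h1, h2, h3⟩ := effect_spec t hev
    unfold Trace.StepAt
    rw [hev]
    exact ⟨h1, h2, h3⟩

end Simulation

/-- Every schedule with a single invocation is followed by an execution, as far as it is
executable. -/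
theorem exists_execution (A : Implementation n V) (m : ℕ) (sched : ℕ → Event n V)
    (hs : ∀ t t' c c' op op', sched t = .invoke c op → sched t' = .invoke c' op' → t = t') :
    ∃ E : Trace A, E.IsExecution m ∧ ∀ t, (E.Ready m t (sched t) → E.ev t = sched t) ∧
      (E.Ready m t (sched t) ∧ E.ev t = sched t ∨ E.ev t = .idle) :=
  ⟨Simulation.trace A m sched, Simulation.isExecution hs, fun t =>
    ⟨Simulation.ev_of_ready, Simulation.ev_cases t⟩⟩

/-! ## Fair executions with crashes at the beginning -/

/-- The commands form a countable set. Reading an enumeration at the first component of `Nat.unpair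
t` repeats each of them infinitely often. -/
theorem exists_fair_commands (n : ℕ) (V : Type u) : ∃ f : ℕ → Event n V,
    (∀ t, (∃ p, f t = .tick p) ∨ ∃ s j, f t = .deliver s j) ∧
    (∀ p T, ∃ t, T ≤ t ∧ f t = .tick p) ∧ ∀ s j T, ∃ t, T ≤ t ∧ f t = .deliver s j := by
  obtain ⟨g, hg⟩ := exists_surjective_nat (Proc n ⊕ (ℕ × ℕ))
  have key : ∀ x T, ∃ t, T ≤ t ∧ g (Nat.unpair t).1 = x := by
    intro x T
    obtain ⟨a, rfl⟩ := hg x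
    exact ⟨Nat.pair a T, Nat.right_le_pair a T, by simp⟩
  refine ⟨fun t => Sum.elim .tick (fun x => .deliver x.1 x.2) (g (Nat.unpair t).1), ?_, ?_, ?_⟩
  · intro t
    rcases hx : g (Nat.unpair t).1 with p | x <;> simp [hx]
  · intro p T
    obtain ⟨t, ht, h⟩ := key (.inl p) T
    exact ⟨t, ht, by simp [h]⟩
  · intro s j T
    obtain ⟨t, ht, h⟩ := key (.inr (s, j)) T
    exact ⟨t, ht, by simp [h]⟩

/-- Schedules in which the replicas in `D` and in `Z` and the client `d` crash at the beginning,
those in `Z` restart, and client `c` invokes `op`. -/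
structure IsSchedule (D Z : Finset (Fin n)) (d c : ℕ) (op : Op V) (f : ℕ → Event n V) : Prop where
  crash_replica : ∀ i : Fin n, i ∈ D ∨ i ∈ Z → f i = .crash (.inl i)
  crash_client : f n = .crash (.inr d)
  restart : ∀ i : Fin n, i ∈ Z → f (n + 1 + i) = .restart i (n + 1 + i)
  invoke : f (2 * n + 1) = .invoke c op
  tick : ∀ p T, ∃ t, T ≤ t ∧ f t = .tick p
  deliver : ∀ s j T, ∃ t, T ≤ t ∧ f t = .deliver s j
  of_crash_replica : ∀ t i, f t = .crash (.inl i) → t = i ∧ (i ∈ D ∨ i ∈ Z)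
  of_crash_client : ∀ t c', f t = .crash (.inr c') → t = n ∧ c' = d
  of_restart : ∀ t i s, f t = .restart i s → i ∈ Z ∧ s = t ∧ t = n + 1 + i
  of_invoke : ∀ t c' op', f t = .invoke c' op' → t = 2 * n + 1 ∧ c' = c ∧ op' = op
  of_tick : ∀ t p, f t = .tick p → 2 * n + 2 ≤ t
  of_deliver : ∀ t s j, f t = .deliver s j → 2 * n + 2 ≤ t

/-- Time layout: replica `i` may crash at `i`, client `d` crashes at `n`, replica `i` may restart at
`n + 1 + i`, the invocation is at `2n + 1`, and fair commands follow from `2n + 2` on. -/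
theorem exists_schedule (D Z : Finset (Fin n)) (d c : ℕ) (op : Op V) :
    ∃ f, IsSchedule D Z d c op f := by
  classical
  obtain ⟨g, hg, hgt, hgd⟩ := exists_fair_commands n V
  let f : ℕ → Event n V := fun t =>
    if h : t < n then if ⟨t, h⟩ ∈ D ∨ ⟨t, h⟩ ∈ Z then .crash (.inl ⟨t, h⟩) else .idle
    else if t = n then .crash (.inr d)
    else if h : t - (n + 1) < n then
      if ⟨t - (n + 1), h⟩ ∈ Z then .restart ⟨t - (n + 1), h⟩ t else .idle
    else if t = 2 * n + 1 then .invoke c op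
    else g t
  have f1 : ∀ t (h : t < n), f t =
      if ⟨t, h⟩ ∈ D ∨ ⟨t, h⟩ ∈ Z then .crash (.inl ⟨t, h⟩) else .idle := fun t h => dif_pos h
  have f2 : f n = .crash (.inr d) := by simp [f]
  have f3 : ∀ i : Fin n, f (n + 1 + i) = if i ∈ Z then .restart i (n + 1 + i) else .idle := by
    intro i
    have h1 : ¬ n + 1 + (i : ℕ) < n := by omega
    have h2 : n + 1 + (i : ℕ) ≠ n := by omega
    simp [f, h1, h2]
  have f4 : f (2 * n + 1) = .invoke c op := by
    have h1 : ¬ 2 * n + 1 < n := by omega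
    have h2 : 2 * n + 1 ≠ n := by omega
    have h3 : ¬ 2 * n + 1 - (n + 1) < n := by omega
    simp only [f, dif_neg h1, if_neg h2, dif_neg h3, if_true]
  have f5 : ∀ t, 2 * n + 2 ≤ t → f t = g t := by
    intro t ht
    have h1 : ¬ t < n := by omega
    have h2 : t ≠ n := by omega
    have h3 : ¬ t - (n + 1) < n := by omega
    have h4 : t ≠ 2 * n + 1 := by omega
    simp only [f, dif_neg h1, if_neg h2, dif_neg h3, if_neg h4]
  have hcases : ∀ t : ℕ, (∃ i : Fin n, t = i ∧ (f t = .idle ∨ (i ∈ D ∨ i ∈ Z) ∧ f t = .crash (.inl i))) ∨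
      (t = n ∧ f t = .crash (.inr d)) ∨
      (∃ i : Fin n, t = n + 1 + i ∧ (f t = .idle ∨ i ∈ Z ∧ f t = .restart i t)) ∨
      (t = 2 * n + 1 ∧ f t = .invoke c op) ∨
      (2 * n + 2 ≤ t ∧ ((∃ p, f t = .tick p) ∨ ∃ s j, f t = .deliver s j)) := by
    intro t
    by_cases h1 : t < n
    · refine .inl ⟨⟨t, h1⟩, rfl, ?_⟩
      rw [f1 t h1]
      split_ifs with h
      exacts [.inr ⟨h, rfl⟩, .inl rfl]
    by_cases h2 : t = n
    · exact .inr (.inl ⟨h2, (congrArg f h2).trans f2⟩)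
    by_cases h3 : t < n + 1 + n
    · refine .inr (.inr (.inl ⟨⟨t - (n + 1), by omega⟩, by simp; omega, ?_⟩))
      have h := f3 ⟨t - (n + 1), by omega⟩
      have ht : n + 1 + (t - (n + 1)) = t := by omega
      simp only [ht] at h
      rw [h]
      split_ifs with h'
      exacts [.inr ⟨h', rfl⟩, .inl rfl]
    by_cases h4 : t = 2 * n + 1
    · exact .inr (.inr (.inr (.inl ⟨h4, (congrArg f h4).trans f4⟩)))
    · have ht : 2 * n + 2 ≤ t := by omega
      exact .inr (.inr (.inr (.inr ⟨ht, by rw [f5 t ht]; exact hg t⟩)))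
  clear_value f
  refine ⟨f, ?_, f2, ?_, f4, ?_, ?_, ?_, ?_, ?_, ?_, ?_, ?_⟩
  · intro i hi
    rw [f1 i i.2]
    exact if_pos hi
  · intro i hi
    rw [f3, if_pos hi]
  · intro p T
    obtain ⟨t, ht, h⟩ := hgt p (max T (2 * n + 2))
    exact ⟨t, by omega, by rw [f5 t (by omega), h]⟩
  · intro s j T
    obtain ⟨t, ht, h⟩ := hgd s j (max T (2 * n + 2))
    exact ⟨t, by omega, by rw [f5 t (by omega), h]⟩
  · intro t i h
    rcases hcases t with ⟨i', h1, h2 | ⟨h3, h2⟩⟩ | ⟨h1, h2⟩ | ⟨i', h1, h2 | ⟨h3, h2⟩⟩ | ⟨h1, h2⟩ |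
      ⟨h1, ⟨p', h2⟩ | ⟨s', j', h2⟩⟩ <;> rw [h] at h2 <;> cases h2
    exact ⟨h1, h3⟩
  · intro t c' h
    rcases hcases t with ⟨i', h1, h2 | ⟨h3, h2⟩⟩ | ⟨h1, h2⟩ | ⟨i', h1, h2 | ⟨h3, h2⟩⟩ | ⟨h1, h2⟩ |
      ⟨h1, ⟨p', h2⟩ | ⟨s', j', h2⟩⟩ <;> rw [h] at h2 <;> cases h2
    exact ⟨h1, rfl⟩
  · intro t i s h
    rcases hcases t with ⟨i', h1, h2 | ⟨h3, h2⟩⟩ | ⟨h1, h2⟩ | ⟨i', h1, h2 | ⟨h3, h2⟩⟩ | ⟨h1, h2⟩ |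
      ⟨h1, ⟨p', h2⟩ | ⟨s', j', h2⟩⟩ <;> rw [h] at h2 <;> cases h2
    exact ⟨h3, rfl, h1⟩
  · intro t c' op' h
    rcases hcases t with ⟨i', h1, h2 | ⟨h3, h2⟩⟩ | ⟨h1, h2⟩ | ⟨i', h1, h2 | ⟨h3, h2⟩⟩ | ⟨h1, h2⟩ |
      ⟨h1, ⟨p', h2⟩ | ⟨s', j', h2⟩⟩ <;> rw [h] at h2 <;> cases h2
    exact ⟨h1, rfl, rfl⟩
  · intro t p h
    rcases hcases t with ⟨i', h1, h2 | ⟨h3, h2⟩⟩ | ⟨h1, h2⟩ | ⟨i', h1, h2 | ⟨h3, h2⟩⟩ | ⟨h1, h2⟩ |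
      ⟨h1, ⟨p', h2⟩ | ⟨s', j', h2⟩⟩ <;> rw [h] at h2 <;> cases h2
    exact h1
  · intro t s j h
    rcases hcases t with ⟨i', h1, h2 | ⟨h3, h2⟩⟩ | ⟨h1, h2⟩ | ⟨i', h1, h2 | ⟨h3, h2⟩⟩ | ⟨h1, h2⟩ |
      ⟨h1, ⟨p', h2⟩ | ⟨s', j', h2⟩⟩ <;> rw [h] at h2 <;> cases h2
    exact h1

/-- The executions that follow such schedules. -/
structure Scenario (A : Implementation n V) (D Z : Finset (Fin n)) (c : ℕ) (op : Op V)
    (E : Trace A) : Prop where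
  exec : E.IsExecution 2
  fair : E.Fair 2
  crash : ∀ t i, E.ev t = .crash (.inl i) → i ∈ D ∨ i ∈ Z
  crash_client : ∀ t c', E.ev t = .crash (.inr c') → c' ≠ c
  restart : ∀ t i s, E.ev t = .restart i s → i ∈ Z ∧ s = t ∧ t = n + 1 + i
  invoke : ∀ t c' op', E.ev t = .invoke c' op' → c' = c ∧ op' = op
  exists_invoke : ∃ t, E.ev t = .invoke c op
  up : ∀ i, i ∉ D → E.EventuallyUp (.inl i)
  down : ∀ i ∈ D, ¬ E.EventuallyUp (.inl i)
  exists_restart : ∀ i ∈ Z, E.ev (n + 1 + i) = .restart i (n + 1 + i)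
  moves : ∀ t i, E.Moves t (.inl i) → i ∉ D ∧ (i ∈ Z → n + 1 + i ≤ t)
  moves_client : ∀ t c', E.Moves t (.inr c') → c' = c

/-- The client `d` is crashed so that fairness never makes it act: it keeps its initial state, which
is needed when two scenarios are joined. All crashes and restarts precede the fair commands, so no
replica acts before its restart. -/
theorem exists_scenario (A : Implementation n V) {D Z : Finset (Fin n)} (hDZ : Disjoint D Z)
    {d c : ℕ} (hdc : d < 2 ∧ c < 2 ∧ d ≠ c) (op : Op V) :
    ∃ E : Trace A, Scenario A D Z c op E := by
  obtain ⟨f, hf⟩ := exists_schedule D Z d c op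
  obtain ⟨E, hE, hEf⟩ := exists_execution A 2 f fun t t' _ _ _ _ h h' =>
    (hf.of_invoke _ _ _ h).1.trans (hf.of_invoke _ _ _ h').1.symm
  have ofev : ∀ {t x}, E.ev t = x → x ≠ .idle → f t = x ∧ E.Ready 2 t x := by
    intro t x h hx
    rcases (hEf t).2 with ⟨h1, h2⟩ | h1
    · rw [h2] at h
      exact ⟨h, h ▸ h1⟩
    · exact absurd (h.symm.trans h1) hx
  have ready : ∀ {t x}, f t = x → E.Ready 2 t x → E.ev t = x := fun h h' =>
    ((hEf _).1 (h ▸ h')).trans h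
  have up0 : ∀ p, (E.cfg 0).up p = true := fun p => by rw [hE.1]
  have hrestart : ∀ t i s, E.ev t = .restart i s → i ∈ Z ∧ s = t ∧ t = n + 1 + i :=
    fun t i s h => hf.of_restart _ _ _ (ofev h (by simp)).1
  have hcr : ∀ i : Fin n, i ∈ D ∨ i ∈ Z → E.ev i = .crash (.inl i) := by
    intro i hi
    refine ready (hf.crash_replica i hi) ⟨trivial, ?_⟩
    refine Trace.up_mono hE (Nat.zero_le _) (up0 _) fun s _ hs hev => ?_
    exact hs.ne (hf.of_crash_replica _ _ (ofev hev (by simp)).1).1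
  have hcd : E.ev n = .crash (.inr d) := by
    refine ready hf.crash_client ⟨hdc.1, ?_⟩
    refine Trace.up_mono hE (Nat.zero_le _) (up0 _) fun s _ hs hev => ?_
    exact hs.ne (hf.of_crash_client _ _ (ofev hev (by simp)).1).1
  have hdownD : ∀ i ∈ D, ∀ t, n ≤ t → (E.cfg t).up (.inl i) = false := by
    intro i hi t ht
    refine Trace.down_mono hE (t := i + 1) (by omega) (Trace.up_succ_crash hE (hcr i (.inl hi))) ?_
    rintro u - - i' s hev heq
    cases heq
    exact Finset.disjoint_left.mp hDZ hi (hrestart _ _ _ hev).1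
  have hdownd : ∀ t, n + 1 ≤ t → (E.cfg t).up (.inr d) = false := fun t ht =>
    Trace.down_mono hE ht (Trace.up_succ_crash hE hcd) (by simp)
  have hres : ∀ i ∈ Z, E.ev (n + 1 + i) = .restart i (n + 1 + i) := by
    intro i hi
    refine ready (hf.restart i hi) ⟨?_, rfl⟩
    refine Trace.down_mono hE (t := i + 1) (by omega) (Trace.up_succ_crash hE (hcr i (.inr hi))) ?_
    rintro u - hu i' s hev heq
    cases heq
    exact hu.ne (hrestart _ _ _ hev).2.2
  have late : ∀ t p, E.Moves t p → (∃ i s, E.ev t = .restart i s ∧ p = .inl i) ∨ p = .inr c ∨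
      2 * n + 2 ≤ t ∧ Present 2 p ∧ (E.cfg t).up p = true := by
    intro t p h
    unfold Trace.Moves at h
    rcases hev : E.ev t with _ | ⟨c', op⟩ | q | ⟨s, j⟩ | q | ⟨i', s⟩ <;> rw [hev] at h <;>
      simp only at h
    · rw [h, (hf.of_invoke _ _ _ (ofev hev (by simp)).1).2.1]
      simp
    · subst h
      obtain ⟨h1, h2⟩ := ofev hev (by simp)
      exact .inr (.inr ⟨hf.of_tick _ _ h1, h2⟩)
    · obtain ⟨e, he, rfl⟩ := h
      obtain ⟨h1, -, -, e', he', h2⟩ := ofev hev (by simp)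
      rw [he] at he'; cases he'
      exact .inr (.inr ⟨hf.of_deliver _ _ _ h1, h2⟩)
    · exact .inl ⟨i', s, rfl, h⟩
  refine ⟨E, hE, ⟨?_, ?_⟩, ?_, ?_, hrestart, ?_, ⟨2 * n + 1, ?_⟩, ?_, ?_, hres, ?_, ?_⟩
  · rintro p hp ⟨U, hU⟩ t
    obtain ⟨t', ht', h⟩ := hf.tick p (max t U)
    exact ⟨t', by omega, ready h ⟨hp, hU t' (by omega)⟩⟩
  · rintro t s j e he hp - hup hts
    obtain ⟨t', ht', h⟩ := hf.deliver s j (s + 1)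
    by_cases hd : ∃ u < t', E.ev u = .deliver s j
    · obtain ⟨u, -, hu⟩ := hd
      exact ⟨u, hu⟩
    · refine ⟨t', ready h ⟨ht', fun u hu hev => hd ⟨u, hu, hev⟩, e, he, hp, hup t' (by omega)⟩⟩
  · intro t i h
    exact (hf.of_crash_replica _ _ (ofev h (by simp)).1).2
  · intro t c' h
    rw [(hf.of_crash_client _ _ (ofev h (by simp)).1).2]
    exact hdc.2.2
  · intro t c' op' h
    exact (hf.of_invoke _ _ _ (ofev h (by simp)).1).2
  · refine ready hf.invoke ⟨hdc.2.1, ?_⟩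
    refine Trace.up_mono hE (Nat.zero_le _) (up0 _) fun s _ _ hev => ?_
    exact hdc.2.2 (hf.of_crash_client _ _ (ofev hev (by simp)).1).2.symm
  · intro i hiD
    by_cases hiZ : i ∈ Z
    · refine ⟨n + 1 + i + 1, fun t ht => ?_⟩
      refine Trace.up_mono hE ht (Trace.up_succ_restart hE (hres i hiZ)) fun s hs _ hev => ?_
      have := (hf.of_crash_replica _ _ (ofev hev (by simp)).1).1
      omega
    · refine ⟨0, Trace.upFrom_of_not_crashes hE ?_⟩
      rintro ⟨t, hev⟩
      exact (hf.of_crash_replica _ _ (ofev hev (by simp)).1).2.elim hiD hiZ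
  · rintro i hi ⟨U, hU⟩
    have h1 := hU (max U n) (le_max_left _ _)
    rw [hdownD i hi _ (le_max_right _ _)] at h1
    cases h1
  · intro t i h
    rcases late t _ h with ⟨i', s, hev, heq⟩ | h | ⟨h1, -, h2⟩
    · cases heq
      obtain ⟨h1, -, h2⟩ := hrestart _ _ _ hev
      exact ⟨fun h => Finset.disjoint_left.mp hDZ h h1, fun _ => h2.ge⟩
    · cases h
    · refine ⟨fun hi => ?_, fun _ => by omega⟩
      rw [hdownD i hi t (by omega)] at h2
      cases h2
  · intro t c' h
    rcases late t _ h with ⟨i', s, hev, heq⟩ | h | ⟨h1, h2, h3⟩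
    · cases heq
    · cases h; rfl
    · have hne : c' ≠ d := by
        rintro rfl
        rw [hdownd t (by omega)] at h3
        cases h3
      simp only [Present] at h2
      omega

variable {A : Implementation n V}

theorem Config.eq_mk {C : Config A} {x : Fin n → A.Vol × A.NV} {y : ℕ → A.CState}
    {z : Proc n → Bool} (hx : C.replica = x) (hy : C.client = y) (hz : C.up = z) :
    C = ⟨x, y, z⟩ := by
  subst hx hy hz
  rfl

theorem ncard_le_card {S : Set (Fin n)} {D : Finset (Fin n)} {k : ℕ} (h : ∀ i ∈ S, i ∈ D)
    (hD : D.card ≤ k) : S.ncard ≤ k := by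
  refine le_trans ?_ hD
  rw [← Set.ncard_coe_finset]
  exact Set.ncard_le_ncard fun i hi => Finset.mem_coe.mpr (h i hi)

/-- A restart here takes the content of its own time, so nothing rolls back: replicas in `D` are
faulty for staying down, those in `Z` are at worst benign. -/
theorem Scenario.bounds {D Z : Finset (Fin n)} {c : ℕ} {op : Op V} {E : Trace A}
    (h : Scenario A D Z c op E) {k b : ℕ} (r : ℕ) (hk : D.card ≤ k) (hb : Z.card ≤ b) :
    E.Bounds k r b := by
  have hroll : ∀ i, ¬ E.RollsBack i := by
    rintro i ⟨t, s, hev, s', h1, h2, hne⟩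
    obtain ⟨-, rfl, -⟩ := h.restart t i s hev
    obtain rfl : s = s' := le_antisymm h1 h2
    exact hne rfl
  refine ⟨ncard_le_card (fun i hi => ?_) hk, ?_, ncard_le_card (fun i hi => ?_) hb⟩
  · by_contra hiD
    exact hi ⟨h.up i hiD, hroll i⟩
  · have : {i | E.RollsBack i} = ∅ := Set.eq_empty_of_forall_notMem hroll
    rw [this]
    simp
  · obtain ⟨⟨hup, -⟩, t, hev⟩ := hi
    exact (h.crash t i hev).resolve_left fun hD => h.down i hD hup

/-- Replicas that have not yet acted are still initial. The bound on `t` includes the state just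
before the restart, whose storage a rollback to time `0` reproduces. -/
theorem Scenario.replica_eq_init {D Z : Finset (Fin n)} {c : ℕ} {op : Op V}
    {E : Trace A} (h : Scenario A D Z c op E) {i : Fin n} {t : ℕ} (hi : i ∈ D ∨ i ∈ Z ∧ t ≤ n + 1 + i) :
    (E.cfg t).replica i = A.replicaInit i := by
  induction t with
  | zero => rw [h.exec.1]
  | succ t ih =>
    rw [Trace.replica_eq_of_not_moves h.exec, ih (hi.imp_right fun hz => ⟨hz.1, by omega⟩)]
    intro hm
    obtain ⟨h1, h2⟩ := h.moves t i hm
    rcases hi with hi | ⟨hi, ht⟩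
    · exact h1 hi
    · have := h2 hi
      omega

theorem Scenario.client_eq_init {D Z : Finset (Fin n)} {c c' : ℕ} {op : Op V}
    {E : Trace A} (h : Scenario A D Z c op E) (hc : c' ≠ c) (t : ℕ) :
    (E.cfg t).client c' = A.clientInit c' := by
  induction t with
  | zero => rw [h.exec.1]
  | succ t ih =>
    rw [Trace.client_eq_of_not_moves h.exec fun hm => hc (h.moves_client t c' hm), ih]

/-! ## Gluing two executions -/

namespace Glue

/-- An event of the first execution: no process crashes. -/
def early : Event n V → Event n V
  | .crash _ => .idle
  | x => x

/-- An event of the second execution, delayed by `T`: only the replicas outside `Y` crash, and a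
restart rolls back to the initial content of the non-volatile storage. -/
def late (Y : Finset (Fin n)) (T : ℕ) : Event n V → Event n V
  | .crash (.inl i) => if i ∈ Y then .idle else .crash (.inl i)
  | .crash (.inr _) => .idle
  | .restart i _ => .restart i 0
  | .deliver s j => .deliver (T + s) j
  | x => x

/-- The global states of the second part: the replicas in `Y`, those in `Z` before their restart,
and the client `0` are in the state in which the first execution leaves them. -/
def lateCfg (E F : Trace A) (Y Z : Finset (Fin n)) (T u : ℕ) : Config A where
  -- The inequality is not strict because index `u` refers to the state before event `u`, and the
  -- restart of `i` is event `n + 1 + i`.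
  replica i := if i ∈ Y ∨ i ∈ Z ∧ u ≤ n + 1 + i then (E.cfg T).replica i else (F.cfg u).replica i
  client c := if c = 0 then (E.cfg T).client 0 else (F.cfg u).client c
  up
    | .inl i => if i ∈ Y then true else (F.cfg u).up (.inl i)
    | .inr _ => true

/-- The execution that follows `E` for `T` steps and then `F` for `T'` steps. -/
def glue (E F : Trace A) (Y Z : Finset (Fin n)) (T T' : ℕ) : Trace A where
  cfg t := if t ≤ T then { E.cfg t with up := fun _ => true }
    else lateCfg E F Y Z T (min (t - T) T')
  ev t := if t < T then early (E.ev t) else if t < T + T' then late Y T (F.ev (t - T)) else .idle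
  sends t := if t < T then E.sends t else if t < T + T' then F.sends (t - T) else []
  resp t := if t < T then E.resp t else if t < T + T' then F.resp (t - T) else none

variable {X Y Z : Finset (Fin n)} {op₁ op₂ : Op V} {E F : Trace A} {T T' : ℕ}

theorem cfg_early {t : ℕ} (h : t ≤ T) :
    (glue E F Y Z T T').cfg t = { E.cfg t with up := fun _ => true } := if_pos h

theorem ev_early {t : ℕ} (h : t < T) : (glue E F Y Z T T').ev t = early (E.ev t) := if_pos h

theorem sends_early {t : ℕ} (h : t < T) : (glue E F Y Z T T').sends t = E.sends t := if_pos h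

theorem resp_early {t : ℕ} (h : t < T) : (glue E F Y Z T T').resp t = E.resp t := if_pos h

theorem ev_late {u : ℕ} (h : u < T') : (glue E F Y Z T T').ev (T + u) = late Y T (F.ev u) := by
  simp [glue, h]

theorem sends_late {u : ℕ} (h : u < T') : (glue E F Y Z T T').sends (T + u) = F.sends u := by
  simp [glue, h]

theorem resp_late {u : ℕ} (h : u < T') : (glue E F Y Z T T').resp (T + u) = F.resp u := by
  simp [glue, h]

/-- At the seam both descriptions of the state agree: replicas outside `Y ∪ Z` lie in `X`, so `E`
leaves them initial, as it does the clients other than `0`. -/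
theorem cfg_late (h₁ : Scenario A X ∅ 0 op₁ E) (h₂ : Scenario A Y Z 1 op₂ F)
    (hcov : ∀ i, i ∈ X ∨ i ∈ Y ∨ i ∈ Z) {u : ℕ} (h : u ≤ T') :
    (glue E F Y Z T T').cfg (T + u) = lateCfg E F Y Z T u := by
  rcases Nat.eq_zero_or_pos u with rfl | hu
  · rw [Nat.add_zero, cfg_early le_rfl]
    simp only [lateCfg, Nat.zero_le, and_true]
    congr 1
    · funext i
      split_ifs with hi
      · rfl
      · rw [h₂.exec.1]
        exact h₁.replica_eq_init (.inl ((hcov i).resolve_right hi))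
    · funext c
      split_ifs with hc
      · rw [hc]
      · rw [h₂.exec.1]
        exact h₁.client_eq_init hc T
    · funext p
      rcases p with i | c
      · simp [h₂.exec.1]
      · rfl
  · have h1 : ¬ T + u ≤ T := by omega
    simp only [glue, if_neg h1, Nat.add_sub_cancel_left, min_eq_left h]

/-- Erasing crashes only makes more processes up, which no step of `E` forbids, since `E` contains
no restarts. -/
theorem stepAt_early (h₁ : Scenario A X ∅ 0 op₁ E) {t : ℕ} (ht : t < T) :
    (glue E F Y Z T T').StepAt 2 t := by
  have h := h₁.exec.2 t
  have c0 := cfg_early (E := E) (F := F) (Y := Y) (Z := Z) (T' := T') ht.le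
  have c1 := cfg_early (E := E) (F := F) (Y := Y) (Z := Z) (T' := T') (Nat.succ_le_of_lt ht)
  have hs := sends_early (E := E) (F := F) (Y := Y) (Z := Z) (T' := T') ht
  have hr := resp_early (E := E) (F := F) (Y := Y) (Z := Z) (T' := T') ht
  rw [Nat.succ_eq_add_one] at c1
  have hrep : ∀ i S, E.ReplicaActs t i S → (glue E F Y Z T T').ReplicaActs t i S := by
    rintro i S ⟨a, ha, h1, h2, h3⟩
    refine ⟨a, ha, ?_, by rw [hs, h2], by rw [hr, h3]⟩
    rw [c1, c0, h1]
    simp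
  have hcl : ∀ c S, E.ClientActs t c S → (glue E F Y Z T T').ClientActs t c S := by
    rintro c S ⟨a, ha, h1, h2, h3⟩
    exact ⟨a, ha, by rw [c1, c0, h1], by rw [hs, h2], by rw [hr, h3]⟩
  have hact : ∀ p x, E.Acts t p x → (glue E F Y Z T T').Acts t p x := by
    rintro (i | c) x h
    · exact hrep i _ h |> (by simpa only [Trace.Acts, c0] using ·)
    · exact hcl c _ h |> (by simpa only [Trace.Acts, c0] using ·)
  unfold Trace.StepAt at h ⊢
  rw [ev_early ht]
  rcases hev : E.ev t with _ | ⟨c, op⟩ | p | ⟨s, j⟩ | p | ⟨i, s⟩ <;> rw [hev] at h <;>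
    simp only [early] at h ⊢
  · exact ⟨by rw [c1, c0, h.1], by rw [hs, h.2.1], by rw [hr, h.2.2]⟩
  · obtain ⟨hc, -, hp, h⟩ := h
    refine ⟨hc, by rw [c0], ?_, by rw [c0]; exact hcl c _ h⟩
    rintro ⟨s, op', hlt, hevs, hrs⟩
    refine hp ⟨s, op', hlt, ?_, fun t' h1 h2 ρ => ?_⟩
    · rw [ev_early (hlt.trans ht)] at hevs
      rcases hev' : E.ev s with _ | _ | _ | _ | _ | _ <;> rw [hev'] at hevs <;>
        simp only [early, reduceCtorEq] at hevs
      exact hevs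
    · rw [← resp_early (h2.trans ht)]
      exact hrs t' h1 h2 ρ
  · exact ⟨h.1, by rw [c0], hact p _ h.2.2⟩
  · obtain ⟨hst, hnd, e, he, hp, -, h⟩ := h
    refine ⟨hst, fun t' ht' hev' => hnd t' ht' ?_, e, ?_, hp, by rw [c0], hact _ _ h⟩
    · rw [ev_early (ht'.trans ht)] at hev'
      rcases hev'' : E.ev t' with _ | _ | _ | _ | _ | _ <;> rw [hev''] at hev' <;>
        simp only [early, reduceCtorEq] at hev'
      exact hev'
    · rw [sends_early (hst.trans ht), he]
  · obtain ⟨-, -, h1, h2, h3⟩ := h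
    exact ⟨by rw [c1, c0, h1], by rw [hs, h2], by rw [hr, h3]⟩
  · exact absurd (h₁.restart t i s hev).1 (Finset.notMem_empty i)

theorem ev_late_invoke {u c : ℕ} {op : Op V} (h : late Y T (F.ev u) = .invoke c op) :
    F.ev u = .invoke c op := by
  rcases hev : F.ev u with _ | _ | _ | _ | (i | c) | _ <;> rw [hev] at h <;>
    simp only [late, reduceCtorEq] at h
  · exact h
  · split_ifs at h

theorem ev_late_deliver {u s j : ℕ} (h : late Y T (F.ev u) = .deliver (T + s) j) :
    F.ev u = .deliver s j := by
  rcases hev : F.ev u with _ | _ | _ | _ | (i | c) | _ <;> rw [hev] at h <;>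
    simp only [late, reduceCtorEq] at h
  · simp only [Event.deliver.injEq, Nat.add_left_cancel_iff] at h
    rw [h.1, h.2]
  · split_ifs at h

theorem ev_early_eq {t : ℕ} {x : Event n V} (h : early (E.ev t) = x) (hx : x ≠ .idle) :
    E.ev t = x := by
  rcases hev : E.ev t with _ | _ | _ | _ | _ | _ <;> rw [hev] at h <;>
    simp only [early] at h <;> first | exact h | exact absurd h.symm hx

/-- Only client `1`, replicas outside `Y`, and, for replicas in `Z`, only from their restart on, act
in `F`. Each of them is then in the same local state as in `F`, except that the restart handler is
given the initial storage by a rollback. All others are frozen. -/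
theorem stepAt_late (h₁ : Scenario A X ∅ 0 op₁ E) (h₂ : Scenario A Y Z 1 op₂ F)
    (hcov : ∀ i, i ∈ X ∨ i ∈ Y ∨ i ∈ Z) {u : ℕ} (hu : u < T') :
    (glue E F Y Z T T').StepAt 2 (T + u) := by
  have h := h₂.exec.2 u
  have c0 := cfg_late (T := T) h₁ h₂ hcov hu.le
  have c1 := cfg_late (T := T) h₁ h₂ hcov (Nat.succ_le_of_lt hu)
  have hs := sends_late (E := E) (F := F) (Y := Y) (Z := Z) (T := T) hu
  have hr := resp_late (E := E) (F := F) (Y := Y) (Z := Z) (T := T) hu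
  rw [Nat.succ_eq_add_one, ← Nat.add_assoc] at c1
  -- The case distinction in `lateCfg` switches for `i ∈ Z` exactly at the restart of `i`; at every
  -- other event both sides fall under the same case.
  have bdry : ∀ i, i ∈ Z → (∀ i' s, F.ev u = .restart i' s → i' ≠ i) → u ≠ n + 1 + i := by
    rintro i hi h rfl
    exact h _ _ (h₂.exists_restart i hi) rfl
  have keep : ∀ i, (∀ i' s, F.ev u = .restart i' s → i' ≠ i) →
      (F.cfg (u + 1)).replica i = (F.cfg u).replica i →
      (lateCfg E F Y Z T (u + 1)).replica i = (lateCfg E F Y Z T u).replica i := by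
    intro i h h'
    have hiff : (i ∈ Y ∨ i ∈ Z ∧ u + 1 ≤ n + 1 + i) ↔ (i ∈ Y ∨ i ∈ Z ∧ u ≤ n + 1 + i) := by
      refine or_congr_right (and_congr_right fun hi => ?_)
      have := bdry i hi h
      omega
    simp only [lateCfg, h', hiff]
  have hrep : ∀ i S, i ∉ Y → (i ∈ Z → n + 1 + i ≤ u) →
      (∀ i' s, F.ev u = .restart i' s → i' = i) →
      F.ReplicaActs u i S → (glue E F Y Z T T').ReplicaActs (T + u) i S := by
    rintro i S hiY hiZ hre ⟨a, ha, h1, h2, h3⟩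
    refine ⟨a, ha, ?_, by rw [hs, h2], by rw [hr, h3]⟩
    rw [c1, c0]
    have hrp : (lateCfg E F Y Z T (u + 1)).replica =
        Function.update (lateCfg E F Y Z T u).replica i a.1 := by
      funext i'
      by_cases hi : i' = i
      · subst hi
        have : ¬ (i' ∈ Y ∨ i' ∈ Z ∧ u + 1 ≤ n + 1 + i') := by
          rintro (h | ⟨h, h'⟩)
          · exact hiY h
          · have := hiZ h
            omega
        simp only [lateCfg, if_neg this, h1, Function.update_self]
      · rw [Function.update_of_ne hi]
        refine keep i' (fun j s hev heq => hi (heq ▸ hre j s hev)) ?_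
        rw [h1]
        exact Function.update_of_ne hi _ _
    have hup : (lateCfg E F Y Z T (u + 1)).up =
        Function.update (lateCfg E F Y Z T u).up (.inl i) true := by
      funext p
      by_cases hp : p = .inl i
      · subst hp
        simp [lateCfg, h1]
      · rw [Function.update_of_ne hp]
        rcases p with i' | c
        · simp only [lateCfg, h1, Function.update_of_ne hp]
        · rfl
    have hclient : (lateCfg E F Y Z T (u + 1)).client = (lateCfg E F Y Z T u).client := by
      simp only [lateCfg, h1]
    exact Config.eq_mk hrp hclient hup
  have hcl : ∀ c S, c ≠ 0 → (∀ i s, F.ev u ≠ .restart i s) →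
      F.ClientActs u c S → (glue E F Y Z T T').ClientActs (T + u) c S := by
    rintro c S hc hre ⟨a, ha, h1, h2, h3⟩
    refine ⟨a, ha, ?_, by rw [hs, h2], by rw [hr, h3]⟩
    rw [c1, c0]
    have hrp : (lateCfg E F Y Z T (u + 1)).replica = (lateCfg E F Y Z T u).replica := by
      funext i
      exact keep i (fun i' s hev => absurd hev (hre i' s)) (by rw [h1])
    have hup : (lateCfg E F Y Z T (u + 1)).up = (lateCfg E F Y Z T u).up := by
      funext p
      rcases p with i' | c
      · simp only [lateCfg, h1]
      · rfl
    have hclient : (lateCfg E F Y Z T (u + 1)).client =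
        Function.update (lateCfg E F Y Z T u).client c a.1 := by
      funext c'
      by_cases hc' : c' = c
      · subst hc'
        simp [lateCfg, h1, hc]
      · rw [Function.update_of_ne hc']
        simp only [lateCfg, h1, Function.update_of_ne hc']
    exact Config.eq_mk hrp hclient hup
  have hact : ∀ p x, F.Moves u p → (∀ i s, F.ev u ≠ .restart i s) →
      F.Acts u p x → (glue E F Y Z T T').Acts (T + u) p x := by
    rintro (i | c) x hm hre h
    · obtain ⟨hiY, hiZ⟩ := h₂.moves u i hm
      have hst : ((glue E F Y Z T T').cfg (T + u)).replica i = (F.cfg u).replica i := by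
        rw [c0]
        refine if_neg ?_
        rintro (h | ⟨h, h'⟩)
        · exact hiY h
        · have := hiZ h
          have := bdry i h fun i' s hev => absurd hev (hre i' s)
          omega
      simp only [Trace.Acts, hst]
      exact hrep i _ hiY hiZ (fun i' s hev => absurd hev (hre i' s)) h
    · obtain rfl := h₂.moves_client u c hm
      have hst : ((glue E F Y Z T T').cfg (T + u)).client 1 = (F.cfg u).client 1 := by
        rw [c0]
        rfl
      simp only [Trace.Acts, hst]
      exact hcl 1 _ one_ne_zero hre h
  have hup : ∀ p, F.Moves u p → (F.cfg u).up p = true →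
      ((glue E F Y Z T T').cfg (T + u)).up p = true := by
    rintro (i | c) hm h
    · rw [c0]
      simpa only [lateCfg, if_neg (h₂.moves u i hm).1] using h
    · rw [c0]
      rfl
  have silent : ∀ C, (∀ i s, F.ev u ≠ .restart i s) →
      F.Silent u { F.cfg u with up := C } → (glue E F Y Z T T').Silent (T + u)
        { lateCfg E F Y Z T u with up := (lateCfg E F Y Z T (u + 1)).up } := by
    rintro C hre ⟨h1, h2, h3⟩
    refine ⟨?_, by rw [hs, h2], by rw [hr, h3]⟩
    rw [c1]
    have hrp : (lateCfg E F Y Z T (u + 1)).replica = (lateCfg E F Y Z T u).replica := by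
      funext i
      exact keep i (fun i' s hev => absurd hev (hre i' s)) (by rw [h1])
    have hclient : (lateCfg E F Y Z T (u + 1)).client = (lateCfg E F Y Z T u).client := by
      simp only [lateCfg, h1]
    exact Config.eq_mk hrp hclient rfl
  have hmoves : ∀ p, F.Moves u p = _ := fun p => by rw [Trace.Moves]
  unfold Trace.StepAt at h ⊢
  rw [ev_late hu]
  rcases hev : F.ev u with _ | ⟨c, op⟩ | p | ⟨s, j⟩ | p | ⟨i, s⟩ <;>
    rw [hev] at h <;> simp only [hev] at hmoves hact silent hcl hrep <;> simp only [late] at h ⊢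
  · have := silent _ (by simp) h
    rw [c0]
    convert this using 2
    funext p
    rcases p with i | c
    · simp only [lateCfg, h.1]
    · rfl
  · obtain ⟨rfl, -⟩ := h₂.invoke u c op hev
    obtain ⟨hc, -, hp, h⟩ := h
    refine ⟨hc, by rw [c0]; rfl, ?_, ?_⟩
    · rintro ⟨s, op', hlt, hevs, hrs⟩
      rcases lt_or_ge s T with hsT | hsT
      · rw [ev_early hsT] at hevs
        exact one_ne_zero (h₁.invoke s _ _ (ev_early_eq hevs (by simp))).1
      · obtain ⟨s, rfl⟩ := Nat.exists_eq_add_of_le hsT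
        have hsu : s < u := by omega
        rw [ev_late (hsu.trans hu)] at hevs
        refine hp ⟨s, op', hsu, ev_late_invoke hevs, fun t' h1 h2 ρ => ?_⟩
        rw [← resp_late (E := E) (Y := Y) (Z := Z) (T := T) (h2.trans hu)]
        exact hrs _ (by omega) (by omega) ρ
    · have hst : ((glue E F Y Z T T').cfg (T + u)).client 1 = (F.cfg u).client 1 := by
        rw [c0]
        rfl
      rw [hst]
      exact hcl 1 _ one_ne_zero (by simp) h
  · have hm : F.Moves u p := by rw [hmoves]
    exact ⟨h.1, hup p hm h.2.1, hact p _ hm (by simp) h.2.2⟩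
  · obtain ⟨hst, hnd, e, he, hp, hue, h⟩ := h
    have hm : F.Moves u e.dst := by rw [hmoves]; exact ⟨e, he, rfl⟩
    refine ⟨by omega, fun t' ht' hev' => ?_, e, by rw [sends_late (hst.trans hu), he], hp,
      hup _ hm hue, hact _ _ hm (by simp) h⟩
    -- The first part cannot have delivered a message sent at `T + s`, since messages are delivered
    -- after they are sent.
    rcases lt_or_ge t' T with htT | htT
    · rw [ev_early htT] at hev'
      have h := h₁.exec.2 t'
      unfold Trace.StepAt at h
      rw [ev_early_eq hev' (by simp)] at h
      have := h.1
      omega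
    · obtain ⟨t', rfl⟩ := Nat.exists_eq_add_of_le htT
      have htu : t' < u := by omega
      rw [ev_late (htu.trans hu)] at hev'
      exact hnd t' htu (ev_late_deliver hev')
  · obtain ⟨hp, hup, h⟩ := h
    have hsil := silent _ (by simp) h
    rcases p with i | c
    · by_cases hi : i ∈ Y
      · simp only [if_pos hi]
        rw [c0]
        convert hsil using 2
        funext p
        rcases p with i' | c
        · simp only [lateCfg, h.1]
          split_ifs with hi'
          · rfl
          · rw [Function.update_of_ne]
            intro heq
            cases heq
            exact hi' hi
        · rfl
      · simp only [if_neg hi]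
        rw [c0]
        refine ⟨trivial, by simpa only [lateCfg, if_neg hi] using hup, ?_⟩
        convert hsil using 2
        funext p
        by_cases hpi : p = .inl i
        · subst hpi
          simp [lateCfg, h.1, hi]
        · rw [Function.update_of_ne hpi]
          rcases p with i' | c
          · simp only [lateCfg, h.1, Function.update_of_ne hpi]
          · rfl
    · rw [c0]
      convert hsil using 2
      funext p
      rcases p with i' | c
      · simp [lateCfg, h.1]
      · rfl
  · have hm : F.Moves u (.inl i) := by rw [hmoves]
    obtain ⟨hiY, hiZ⟩ := h₂.moves u i hm
    obtain ⟨hi, rfl, hsi⟩ := h₂.restart u i s hev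
    obtain ⟨hd, -, h⟩ := h
    refine ⟨?_, Nat.zero_le _, hrep i _ hiY hiZ ?_ ?_⟩
    · rw [c0]
      simpa only [lateCfg, if_neg hiY] using hd
    · rintro i' s' h
      cases h
      rfl
    -- The rollback goes to time `0`, and in `F` the replica restarts with storage that is still
    -- initial, so the handler receives the same input.
    · have hnv : (glue E F Y Z T T').nv 0 i = F.nv s i := by
        simp only [Trace.nv, cfg_early (Nat.zero_le T), h₁.exec.1,
          h₂.replica_eq_init (.inr ⟨hi, hsi.le⟩)]
      rw [hnv]
      exact h

theorem isExecution (h₁ : Scenario A X ∅ 0 op₁ E) (h₂ : Scenario A Y Z 1 op₂ F)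
    (hcov : ∀ i, i ∈ X ∨ i ∈ Y ∨ i ∈ Z) : (glue E F Y Z T T').IsExecution 2 := by
  refine ⟨by rw [cfg_early (Nat.zero_le T), h₁.exec.1], fun t => ?_⟩
  rcases lt_or_ge t T with ht | ht
  · exact stepAt_early h₁ ht
  obtain ⟨u, rfl⟩ := Nat.exists_eq_add_of_le ht
  rcases lt_or_ge u T' with hu | hu
  · exact stepAt_late h₁ h₂ hcov hu
  · have h1 : ¬ T + u < T := by omega
    have h2 : ¬ T + u < T + T' := by omega
    have hev : (glue E F Y Z T T').ev (T + u) = .idle := by simp only [glue, if_neg h1, if_neg h2]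
    unfold Trace.StepAt
    rw [hev]
    refine ⟨?_, by simp only [glue, if_neg h1, if_neg h2], by simp only [glue, if_neg h1, if_neg h2]⟩
    rcases Nat.eq_zero_or_pos u with rfl | hu0
    · obtain rfl : T' = 0 := by omega
      have h3 := cfg_late (T := T) h₁ h₂ hcov (le_refl 0)
      show (glue E F Y Z T 0).cfg (T + 1) = (glue E F Y Z T 0).cfg (T + 0)
      rw [h3]
      simp [glue]
    · have h3 : ¬ T + u ≤ T := by omega
      have h4 : ¬ T + u + 1 ≤ T := by omega
      have h5 : T + u + 1 - T = u + 1 := by omega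
      simp only [glue, if_neg h3, if_neg h4, h5, Nat.add_sub_cancel_left, min_eq_right hu,
        min_eq_right (hu.trans u.le_succ)]

theorem ev_cases {t : ℕ} {x : Event n V} (h : (glue E F Y Z T T').ev t = x) (hx : x ≠ .idle) :
    t < T ∧ E.ev t = x ∨ ∃ u < T', t = T + u ∧ late Y T (F.ev u) = x := by
  rcases lt_or_ge t T with ht | ht
  · rw [ev_early ht] at h
    exact .inl ⟨ht, ev_early_eq h hx⟩
  · obtain ⟨u, rfl⟩ := Nat.exists_eq_add_of_le ht
    rcases lt_or_ge u T' with hu | hu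
    · rw [ev_late hu] at h
      exact .inr ⟨u, hu, rfl, h⟩
    · have h1 : ¬ T + u < T := by omega
      have h2 : ¬ T + u < T + T' := by omega
      simp only [glue, if_neg h1, if_neg h2] at h
      exact absurd h.symm hx

/-- With the crashes of `X` and `Y` erased, only replicas in `Z` ever crash or roll back, so this
set alone accounts for all three counts. -/
theorem bounds (h₁ : Scenario A X ∅ 0 op₁ E) (h₂ : Scenario A Y Z 1 op₂ F)
    (hcov : ∀ i, i ∈ X ∨ i ∈ Y ∨ i ∈ Z) {k r b : ℕ} (hk : Z.card ≤ k) (hr : Z.card ≤ r)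
    (hb : Z.card ≤ b) : (glue E F Y Z T T').Bounds k r b := by
  have hcrash : ∀ i, (glue E F Y Z T T').Crashes (.inl i) → i ∈ Z := by
    rintro i ⟨t, hev⟩
    rcases lt_or_ge t T with ht | ht
    · rw [ev_early ht] at hev
      rcases hev' : E.ev t with _ | _ | _ | _ | _ | _ <;> rw [hev'] at hev <;>
        simp only [early, reduceCtorEq] at hev
    · rcases ev_cases hev (by simp) with h | ⟨u, -, -, hl⟩
      · omega
      · rcases hev' : F.ev u with _ | _ | _ | _ | (i' | c) | _ <;> rw [hev'] at hl <;>
          simp only [late, reduceCtorEq] at hl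
        split_ifs at hl with hY
        cases hl
        exact (h₂.crash u i hev').resolve_left hY
  have hroll : ∀ i, (glue E F Y Z T T').RollsBack i → i ∈ Z := by
    rintro i ⟨t, s, hev, -⟩
    rcases ev_cases hev (by simp) with ⟨-, h⟩ | ⟨u, -, -, hl⟩
    · exact absurd (h₁.restart _ _ _ h).1 (Finset.notMem_empty i)
    · rcases hev' : F.ev u with _ | _ | _ | _ | (i' | c) | _ <;> rw [hev'] at hl <;>
        simp only [late, reduceCtorEq] at hl
      · split_ifs at hl
      · cases hl
        exact (h₂.restart _ _ _ hev').1
  refine ⟨ncard_le_card (fun i hi => ?_) hk, ncard_le_card hroll hr,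
    ncard_le_card (fun i hi => hcrash i hi.2) hb⟩
  by_contra hiZ
  refine hi ⟨⟨0, ?_⟩, fun h => hiZ (hroll i h)⟩
  exact Trace.upFrom_of_not_crashes (isExecution h₁ h₂ hcov) fun h => hiZ (hcrash i h)

theorem completes_early {o t : ℕ} {ρ : Resp V} (h : E.Completes o t ρ) (ht : t < T) :
    (glue E F Y Z T T').Completes o t ρ := by
  obtain ⟨c, op, hev, hot, hr, hmin⟩ := h
  refine ⟨c, op, ?_, hot, by rw [resp_early ht, hr], fun t' h1 h2 => ?_⟩
  · rw [ev_early (hot.trans_lt ht), hev]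
    rfl
  · rw [resp_early (h2.trans ht)]
    exact hmin t' h1 h2

theorem completes_late {o t : ℕ} {ρ : Resp V} (h : F.Completes o t ρ) (ht : t < T') :
    (glue E F Y Z T T').Completes (T + o) (T + t) ρ := by
  obtain ⟨c, op, hev, hot, hr, hmin⟩ := h
  refine ⟨c, op, ?_, by omega, by rw [resp_late ht, hr], fun t' h1 h2 => ?_⟩
  · rw [ev_late (hot.trans_lt ht), hev]
    rfl
  · obtain ⟨u, rfl⟩ := Nat.exists_eq_add_of_le (show T ≤ t' by omega)
    rw [resp_late (by omega)]
    exact hmin u (by omega) (by omega)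

end Glue

/-! ### The lower bound -/

theorem Trace.Linearizable.read_eq_init {E : Trace A} {v₀ : V} (h : E.Linearizable v₀)
    (hw : ∀ t c v, E.ev t ≠ .invoke c (.write v)) {o t c : ℕ} {ρ : Resp V}
    (hev : E.ev o = .invoke c .read) (hc : E.Completes o t ρ) : ρ = .val v₀ := by
  obtain ⟨-, L, R, -, -, -, -, -, -, -, hread⟩ := h
  obtain ⟨v, rfl, ⟨rfl, -⟩ | ⟨w, -, c', h, -⟩⟩ := hread o c t ρ hev hc
  · rfl
  · exact absurd h (hw _ _ _)

/-- Once a write of `v` has completed, and if only `v` is written, no read returns another value. -/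
theorem Trace.Linearizable.read_eq_write {E : Trace A} {v₀ v : V} (h : E.Linearizable v₀)
    (hw : ∀ t c v', E.ev t = .invoke c (.write v') → v' = v) {o o' t t' c c' : ℕ} {ρ ρ' : Resp V}
    (hev : E.ev o = .invoke c (.write v)) (hc : E.Completes o t ρ) (ht : t < o')
    (hev' : E.ev o' = .invoke c' .read) (hc' : E.Completes o' t' ρ') : ρ' = .val v := by
  obtain ⟨-, L, R, -, hL, -, -, -, hreal, -, hread⟩ := h
  obtain ⟨v', rfl, ⟨-, hno⟩ | ⟨w, -, c'', h, -⟩⟩ := hread o' c' t' ρ' hev' hc'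
  · exact absurd (hreal o (hL _ _ _ hc) o' (hL _ _ _ hc') t ρ hc ht) (hno o (hL _ _ _ hc) c v hev)
  · rw [hw _ _ _ h]

/-- With too few replicas, the write scenario and the read scenario share no replica whose memory
survives: outside `X` and `Y` there are only replicas that can be rolled back in the glued execution
and counted as benign in the read scenario. -/
theorem le_of_isTolerantRegister [Nontrivial V] (v₀ : V) {k r b : ℕ} (hr : r ≤ k)
    (hA : IsTolerantRegister A v₀ k r b) : 2 * k + min b r + 1 ≤ n := by
  classical
  by_contra hn
  obtain ⟨v, hv⟩ := exists_ne v₀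
  let X : Finset (Fin n) := Finset.univ.filter fun i => (i : ℕ) < k
  let Y : Finset (Fin n) := Finset.univ.filter fun i => k ≤ (i : ℕ) ∧ (i : ℕ) < k + k
  let Z : Finset (Fin n) := Finset.univ.filter fun i => k + k ≤ (i : ℕ)
  have hcard : ∀ (S : Finset (Fin n)) (a l : ℕ), (∀ i ∈ S, a ≤ (i : ℕ) ∧ (i : ℕ) < a + l) →
      S.card ≤ l := by
    intro S a l h
    have := Finset.card_le_card_of_injOn (s := S) (t := Finset.Ico a (a + l)) (fun i => (i : ℕ))
      (fun i hi => Finset.mem_coe.mpr (Finset.mem_Ico.mpr (h i hi)))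
      (fun i _ j _ h => Fin.ext h)
    simpa using this
  have hX : X.card ≤ k := hcard X 0 k fun i hi => by simpa [X] using hi
  have hY : Y.card ≤ k := hcard Y k k fun i hi => by simpa [Y] using hi
  have hZ : Z.card ≤ min b r := hcard Z (k + k) _ fun i hi => by
    have : k + k ≤ (i : ℕ) := by simpa [Z] using hi
    have := i.2
    omega
  have hcov : ∀ i, i ∈ X ∨ i ∈ Y ∨ i ∈ Z := by
    intro i
    simp only [X, Y, Z, Finset.mem_filter, Finset.mem_univ, true_and]
    omega
  have hYZ : Disjoint Y Z := Finset.disjoint_left.mpr fun i => by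
    simp only [Y, Z, Finset.mem_filter, Finset.mem_univ, true_and]
    omega
  obtain ⟨E, hE⟩ := exists_scenario A (Finset.disjoint_empty_right X) (d := 1) (c := 0) (by simp)
    (.write v)
  obtain ⟨F, hF⟩ := exists_scenario A hYZ (d := 0) (c := 1) (by simp) .read
  have hZb := hZ.trans (min_le_left b r)
  have hZr := hZ.trans (min_le_right b r)
  obtain ⟨o₁, ho₁⟩ := hE.exists_invoke
  obtain ⟨t₁, ρ₁, hc₁⟩ := (hA 2 E hE.exec (hE.bounds r hX (by simp))).2 hE.fair _ _ _ ho₁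
    fun ⟨t, ht⟩ => hE.crash_client _ _ ht rfl
  obtain ⟨o₂, ho₂⟩ := hF.exists_invoke
  obtain ⟨hlin, hwf⟩ := hA 2 F hF.exec (hF.bounds r hY hZb)
  obtain ⟨t₂, ρ₂, hc₂⟩ := hwf hF.fair _ _ _ ho₂ fun ⟨t, ht⟩ => hF.crash_client _ _ ht rfl
  have hρ₂ := hlin.read_eq_init (fun t c v h => by cases (hF.invoke _ _ _ h).2) ho₂ hc₂
  have hot₁ : o₁ ≤ t₁ := by obtain ⟨-, -, -, h, -⟩ := hc₁; exact h
  have hot₂ : o₂ ≤ t₂ := by obtain ⟨-, -, -, h, -⟩ := hc₂; exact h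
  -- Each part is cut just after its response. Only linearizability is used, so the glued execution
  -- need not be fair. The replicas in `Z` are now possibly faulty, which `r ≤ k` allows.
  have hG := (hA 2 (Glue.glue E F Y Z (t₁ + 1) (t₂ + 1)) (Glue.isExecution hE hF hcov)
    (Glue.bounds hE hF hcov (hZr.trans hr) hZr hZb)).1
  have hread := hG.read_eq_write (v := v) (o := o₁) (t := t₁) (c := 0) (o' := t₁ + 1 + o₂) (c' := 1)
    ?_ (by rw [Glue.ev_early (by omega), ho₁]; rfl) (Glue.completes_early hc₁ t₁.lt_succ_self)
    (by omega) (by rw [Glue.ev_late (by omega), ho₂]; rfl)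
    (Glue.completes_late hc₂ t₂.lt_succ_self)
  · rw [hρ₂] at hread
    cases hread
    exact hv rfl
  · intro t c v' h
    rcases Glue.ev_cases h (by simp) with ⟨-, h⟩ | ⟨u, -, -, h⟩
    · cases (hE.invoke _ _ _ h).2
      rfl
    · cases (hF.invoke _ _ _ (Glue.ev_late_invoke h)).2

end CRR

theorem mainTheorem1 {V : Type u} [Nontrivial V] (v₀ : V) (n k r b : ℕ) (hr : r ≤ k) (hb : b ≤ n) :
    (∃ A : CRR.Implementation n V, CRR.IsTolerantRegister A v₀ k r b) ↔
      2 * k + min b r + 1 ≤ n :=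
  ⟨fun ⟨_, hA⟩ => CRR.le_of_isTolerantRegister v₀ hr hA, CRR.Quorum.exists_tolerant v₀⟩
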